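/- Let $\mathcal H$ be a separable (possibly finite-dimensional) complex Hilbert space, $X$ a locally compact Hausdorff space with its Borel $\sigma$-algebra, and let $\mathcal S(\mathcal K)$ denote the positive trace-one operators on a Hilbert space $\mathcal K$. Let $\nu$ be a positive operator-valued measure (POVM) on $X$ with values in $\mathcal B(\mathcal H)$, i.e. $\nu(E)\ge 0$ and $\nu$ is ultraweakly countably additive; let $\rho\in\mathcal S(\mathcal H)$ be of full rank (injective), and put $\nu_\rho(E)=\operatorname{tr}(\rho\,\nu(E))$. A quantum random variable is a function $f:X\to\mathcal B(\mathcal H)$ with $x\mapsto\operatorname{tr}(sf(x))$ measurable for all $s\in\mathcal S(\mathcal H)$. Assume that $\nu$ has a Radon–Nikodým derivative $D=\frac{d\nu}{d\nu_\rho}$, i.e. a quantum random variable $D:X\to\mathcal B(\mathcal H)$ whose matrix entries in an orthonormal basis $(e_i)$ are the densities of $E\mapsto\langle\nu(E)e_j,e_i\rangle$ with respect to $\nu_\rho$. Let $\mathcal L_{\mathcal H}$ be the linear span of the positive quantum random variables. For $f\in\mathcal L_{\mathcal H}$ and $s\in\mathcal S(\mathcal H)$ put $f_s=\operatorname{tr}(sD^{1/2}fD^{1/2})$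 and $$\|f\|_1=\inf\Big\{\sup_{s}\int_X (f_1+f_2+f_3+f_4)_s\,d\nu_\rho : f=f_1-f_2+if_3-if_4,\ 0\le f_k\in\mathcal L_{\mathcal H}\Big\}\in[0,\infty],$$ $$\|f\|_{1,dec}=\inf\Big\{\max(\|S_1\|_1,\|S_2\|_1): 0\le S_1,S_2\in\mathcal L_{\mathcal H},\ \begin{bmatrix}S_1(x)&f(x)\\ f(x)^*&S_2(x)\end{bmatrix}\ge 0\ \text{a.e.}\Big\}.$$ $L^1_{\mathcal H}(X,\nu)$ is the space of $f\in\mathcal L_{\mathcal H}$ with $\|f\|_1<\infty$, modulo those with $\|f\|_1=0$. $L^\infty_{\mathcal H}(X,\nu)$ is the space of ($\nu_\rho$-a.e. classes of) quantum random variables $g$ with $\|g\|_\infty=\operatorname{ess\,sup}_{\nu_\rho}\|g(x)\|<\infty$. The same definitions are used for a POVM with values in $\mathcal B(\mathcal H\otimes\mathcal H)$ and a full-rank density operator on the Hilbert space tensor product $\mathcal H\otimes\mathcal H$. **Theorem.** Suppose that $D\in L^\infty_{\mathcal H}(X,\nu)$ and that $D(x)$ is invertible in $\mathcal B(\mathcal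 H)$ for $\nu_\rho$-a.e. $x$. Then there is a POVM $\nu\otimes_{\nu_\rho}\nu$ with values in $\mathcal B(\mathcal H\otimes\mathcal H)$ given by $\operatorname{tr}\big(s\,(\nu\otimes_{\nu_\rho}\nu)(E)\big)=\int_E\operatorname{tr}\big(s\,(D\otimes D)\big)\,d\nu_\rho$ for all Borel $E$ and $s\in\mathcal S(\mathcal H\otimes\mathcal H)$, and it has a Radon–Nikodým derivative, with values in bounded operators, with respect to $\operatorname{tr}\big(\sigma\,(\nu\otimes_{\nu_\rho}\nu)(\cdot)\big)$ for every full-rank $\sigma\in\mathcal S(\mathcal H\otimes\mathcal H)$. If $f\in L^1_{\mathcal H}(X,\nu)$ and $g\in L^\infty_{\mathcal H}(X,\nu)$, then the pointwise tensor product $f\otimes g$ is a well-defined element of $L^1_{\mathcal H\otimes\mathcal H}(X,\nu\otimes_{\nu_\rho}\nu)$ (formed with any full-rank $\sigma$), and $$\|f\otimes g\|_1\le 2\,\|D\|_\infty\,\|f\|_1\,\|g\|_\infty,\qquad \|f\otimes g\|_{1,dec}\le \|D\|_\infty\,\|f\|_{1,dec}\,\|g\|_\infty .$$ -/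

import Mathlib

open MeasureTheory
open scoped ENNReal TensorProduct ComplexOrder InnerProductSpace

noncomputable section

namespace QRV

section Trace

variable {H : Type*} [NormedAddCommGroup H] [InnerProductSpace ℂ H] [CompleteSpace H]

/-- The index set of a fixed orthonormal (Hilbert) basis of `H`. -/
def basisIndex (H : Type*) [NormedAddCommGroup H] [InnerProductSpace ℂ H] [CompleteSpace H] :
    Set H :=
  (exists_hilbertBasis ℂ H).choose

/-- A fixed orthonormal (Hilbert) basis of `H`. -/
def basis (H : Type*) [NormedAddCommGroup H] [InnerProductSpace ℂ H] [CompleteSpace H] :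
    HilbertBasis (basisIndex H) ℂ H :=
  (exists_hilbertBasis ℂ H).choose_spec.choose

/-- The trace `∑ᵢ ⟨T eᵢ, eᵢ⟩` of an operator (meaningful for trace class operators). -/
def trace (T : H →L[ℂ] H) : ℂ :=
  ∑' i, ⟪basis H i, T (basis H i)⟫_ℂ

/-- The density operators of `H`: positive operators of trace one. (The trace being a convergent
sum is part of `trace s = 1`, since a divergent `tsum` is `0`.) -/
def State (H : Type*) [NormedAddCommGroup H] [InnerProductSpace ℂ H] [CompleteSpace H] : Type _ :=
  {s : H →L[ℂ] H // 0 ≤ s ∧ trace s = 1}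

/-- The operator underlying a density operator. -/
def State.op (s : State H) : H →L[ℂ] H := s.1

/-- A density operator is of full rank if it has trivial kernel (equivalently, dense range). -/
def State.FullRank (s : State H) : Prop := Function.Injective s.op

theorem hasSum_norm_inner_sq (x : H) :
    HasSum (fun i => ‖⟪basis H i, x⟫_ℂ‖ ^ 2) (‖x‖ ^ 2) := by
  have h := (basis H).hasSum_inner_mul_inner x x
  have h2 := Complex.hasSum_re h
  have e : (⟪x, x⟫_ℂ).re = ‖x‖ ^ 2 := by
    rw [inner_self_eq_norm_sq_to_K]; norm_cast
  rw [e] at h2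
  convert h2 using 2 with i
  rw [← inner_conj_symm x (basis H i), RCLike.conj_mul]
  norm_cast

theorem hs_prod (T : H →L[ℂ] H) (hT : Summable fun i => ‖T (basis H i)‖ ^ 2) :
    Summable fun p : basisIndex H × basisIndex H => ‖⟪basis H p.2, T (basis H p.1)⟫_ℂ‖ ^ 2 := by
  rw [summable_prod_of_nonneg (fun p => by positivity)]
  refine ⟨fun i => (hasSum_norm_inner_sq (T (basis H i))).summable, ?_⟩
  have e : ∀ i, ∑' j, ‖⟪basis H j, T (basis H i)⟫_ℂ‖ ^ 2 = ‖T (basis H i)‖ ^ 2 :=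
    fun i => (hasSum_norm_inner_sq (T (basis H i))).tsum_eq
  simp only [e]
  exact hT

/-- For positive `s`, `A` with `s` of trace one, `tr (s A) ≥ 0`. -/
theorem trace_mul_nonneg (s : State H) {A : H →L[ℂ] H} (hA : 0 ≤ A) :
    0 ≤ trace (s.op * A) := by
  obtain ⟨s, hs, hs1⟩ := s
  change 0 ≤ trace (s * A)
  set r := CFC.sqrt s with hr
  have hrr : r * r = s := CFC.sqrt_mul_sqrt_self s hs
  have hr0 : r.IsPositive := (ContinuousLinearMap.nonneg_iff_isPositive r).1 (CFC.sqrt_nonneg s)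
  have hAp : A.IsPositive := (ContinuousLinearMap.nonneg_iff_isPositive A).1 hA
  have rs : ∀ x y, ⟪r x, y⟫_ℂ = ⟪x, r y⟫_ℂ := fun x y => hr0.inner_left_eq_inner_right x y
  have As : ∀ x y, ⟪A x, y⟫_ℂ = ⟪x, A y⟫_ℂ := fun x y => hAp.inner_left_eq_inner_right x y
  have hsum : Summable fun i => ⟪basis H i, s (basis H i)⟫_ℂ := by
    by_contra h
    rw [trace, tsum_eq_zero_of_not_summable h] at hs1
    exact zero_ne_one hs1
  have h1 : Summable fun i => ‖r (basis H i)‖ ^ 2 := by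
    have h := (Complex.hasSum_re hsum.hasSum).summable
    convert h using 2 with i
    rw [← hrr, mul_apply_eq_comp, ← rs, inner_self_eq_norm_sq_to_K]
    norm_cast
  have h2 : Summable fun i => ‖(A * r) (basis H i)‖ ^ 2 := by
    refine Summable.of_nonneg_of_le (fun i => by positivity) (fun i => ?_)
      (h1.mul_left (‖A‖ ^ 2))
    rw [← mul_pow]
    gcongr
    exact A.le_opNorm _
  have p1 := hs_prod r h1
  have p2 := hs_prod (A * r) h2
  have hF : Summable fun p : basisIndex H × basisIndex H =>
      ⟪(A * r) (basis H p.1), basis H p.2⟫_ℂ * ⟪basis H p.2, r (basis H p.1)⟫_ℂ := by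
    refine Summable.of_norm_bounded (p1.add p2) (fun p => ?_)
    rw [norm_mul, norm_inner_symm]
    nlinarith [sq_nonneg (‖⟪basis H p.2, r (basis H p.1)⟫_ℂ‖ -
      ‖⟪basis H p.2, (A * r) (basis H p.1)⟫_ℂ‖),
      sq_nonneg (‖⟪basis H p.2, r (basis H p.1)⟫_ℂ‖),
      sq_nonneg ‖⟪basis H p.2, (A * r) (basis H p.1)⟫_ℂ‖]
  have key : trace (s * A) = ∑' j, ⟪(A * r) (basis H j), r (basis H j)⟫_ℂ := by
    have e1 : ∀ j, ⟪(A * r) (basis H j), r (basis H j)⟫_ℂ =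
        ∑' i, ⟪(A * r) (basis H j), basis H i⟫_ℂ * ⟪basis H i, r (basis H j)⟫_ℂ :=
      fun j => ((basis H).tsum_inner_mul_inner _ _).symm
    have e2 : ∀ i, ⟪basis H i, (s * A) (basis H i)⟫_ℂ =
        ∑' j, ⟪(A * r) (basis H j), basis H i⟫_ℂ * ⟪basis H i, r (basis H j)⟫_ℂ := by
      intro i
      rw [← hrr, mul_apply_eq_comp, mul_apply_eq_comp, ← rs,
        ← (basis H).tsum_inner_mul_inner]
      refine tsum_congr fun j => ?_
      rw [mul_comm, mul_apply_eq_comp, As, rs, rs]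
    simp only [trace, e1, e2]
    exact Summable.tsum_comm hF
  rw [key]
  exact tsum_nonneg fun j => hAp.inner_nonneg_left _

end Trace

section Measures

variable {X : Type*} [MeasurableSpace X]
variable {H : Type*} [NormedAddCommGroup H] [InnerProductSpace ℂ H] [CompleteSpace H]

/-- A positive operator-valued measure: positive on measurable sets and ultraweakly countably
additive, i.e. `tr (s ν(⋃ Eₖ)) = ∑ₖ tr (s ν(Eₖ))` for every density operator `s`. -/
structure POVM (X : Type*) [MeasurableSpace X]
    (H : Type*) [NormedAddCommGroup H] [InnerProductSpace ℂ H] [CompleteSpace H] where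
  /-- The operator assigned to a set. -/
  toFun : Set X → (H →L[ℂ] H)
  /-- Junk value `0` off the `σ`-algebra. -/
  not_measurable : ∀ E, ¬ MeasurableSet E → toFun E = 0
  nonneg : ∀ E, MeasurableSet E → 0 ≤ toFun E
  hasSum_iUnion : ∀ E : ℕ → Set X, (∀ k, MeasurableSet (E k)) →
    Pairwise (Function.onFun Disjoint E) →
    ∀ s : State H, HasSum (fun k => trace (s.op * toFun (E k))) (trace (s.op * toFun (⋃ k, E k)))

theorem POVM.trace_empty (ν : POVM X H) (s : State H) : trace (s.op * ν.toFun ∅) = 0 := by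
  have h := ν.hasSum_iUnion (fun _ => ∅) (fun _ => MeasurableSet.empty)
    (fun _ _ _ => by simp [Function.onFun]) s
  exact (summable_const_iff _).1 h.summable

/-- The finite positive measure `ν_ρ(E) = tr (ρ ν(E))`. -/
def POVM.stateMeasure (ν : POVM X H) (ρ : State H) : Measure X :=
  Measure.ofMeasurable (fun E _ => ENNReal.ofReal (trace (ρ.op * ν.toFun E)).re)
    (by simp [ν.trace_empty])
    (by
      intro E hE hd
      have h := Complex.hasSum_re (ν.hasSum_iUnion E hE hd ρ)
      change ENNReal.ofReal _ = _
      rw [← h.tsum_eq]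
      exact ENNReal.ofReal_tsum_of_nonneg
        (fun k => (Complex.nonneg_iff.1 (trace_mul_nonneg ρ (ν.nonneg _ (hE k)))).1) h.summable)

/-- Quantum random variables: `x ↦ tr (s f(x))` is measurable for every density operator `s`. -/
def IsQRV (f : X → (H →L[ℂ] H)) : Prop :=
  ∀ s : State H, Measurable fun x => trace (s.op * f x)

/-- `D` is a version of the Radon-Nikodým derivative `dν/dμ`: an operator-valued quantum random
variable whose matrix entries are the Radon-Nikodým derivatives `dν_{ij}/dμ` of the complex
measures `ν_{ij}(E) = ⟨ν(E) e_j, e_i⟩`. -/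
def IsRNDeriv (ν : POVM X H) (μ : Measure X) (D : X → (H →L[ℂ] H)) : Prop :=
  IsQRV D ∧ ∀ i j,
    Integrable (fun x => ⟪basis H i, D x (basis H j)⟫_ℂ) μ ∧
    ∀ E, MeasurableSet E →
      ⟪basis H i, ν.toFun E (basis H j)⟫_ℂ = ∫ x in E, ⟪basis H i, D x (basis H j)⟫_ℂ ∂μ

/-- `ν` has a Radon-Nikodým derivative with respect to `μ` taking values in bounded operators. -/
def HasRNDeriv (ν : POVM X H) (μ : Measure X) : Prop :=
  ∃ D, IsRNDeriv ν μ D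

open Classical in
/-- The Radon-Nikodým derivative `dν/dμ` (a fixed version; `0` if there is none). -/
def rnDeriv (ν : POVM X H) (μ : Measure X) : X → (H →L[ℂ] H) :=
  if h : HasRNDeriv ν μ then h.choose else 0

/-- The span of the positive quantum random variables. -/
def qrvSpan (X : Type*) [MeasurableSpace X]
    (H : Type*) [NormedAddCommGroup H] [InnerProductSpace ℂ H] [CompleteSpace H] :
    Submodule ℂ (X → (H →L[ℂ] H)) :=
  Submodule.span ℂ {f | IsQRV f ∧ ∀ x, 0 ≤ f x}

/-- The 4-tuples of positive functions `f₁, …, f₄` with `f = f₁ - f₂ + i f₃ - i f₄`. -/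
def Pos (f : X → (H →L[ℂ] H)) : Set (Fin 4 → X → (H →L[ℂ] H)) :=
  {F | (∀ k, F k ∈ qrvSpan X H ∧ ∀ x, 0 ≤ F k x) ∧
    f = F 0 - F 1 + Complex.I • F 2 - Complex.I • F 3}

/-- `f_s(x) = tr (s (dν/dν_ρ)(x)^{1/2} f(x) (dν/dν_ρ)(x)^{1/2})`. -/
def slice (ν : POVM X H) (ρ s : State H) (f : X → (H →L[ℂ] H)) (x : X) : ℂ :=
  trace (s.op * (CFC.sqrt (rnDeriv ν (ν.stateMeasure ρ) x) * f x *
    CFC.sqrt (rnDeriv ν (ν.stateMeasure ρ) x)))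

/-- The seminorm `‖f‖_p = inf_{Pos f} sup_s ‖(f₁ + f₂ + f₃ + f₄)_s‖_{L^p(ν_ρ)}`. -/
def pNorm (ν : POVM X H) (ρ : State H) (p : ℝ≥0∞) (f : X → (H →L[ℂ] H)) : ℝ≥0∞ :=
  ⨅ F ∈ Pos f, ⨆ s : State H,
    eLpNorm (slice ν ρ s (F 0 + F 1 + F 2 + F 3)) p (ν.stateMeasure ρ)

/-- Membership in `L^p_H(X, ν)`, for functions (representatives of classes modulo the functions
of seminorm zero). -/
def MemLpOp (ν : POVM X H) (ρ : State H) (p : ℝ≥0∞) (f : X → (H →L[ℂ] H)) : Prop :=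
  f ∈ qrvSpan X H ∧ pNorm ν ρ p f < ∞

/-- Positivity of the operator matrix `[[S₁, f], [f*, S₂]]` on `H ⊕ H`. -/
def BlockNonneg (S₁ f S₂ : H →L[ℂ] H) : Prop :=
  ∀ ξ η : H, 0 ≤ ⟪ξ, S₁ ξ⟫_ℂ + ⟪ξ, f η⟫_ℂ + ⟪η, ContinuousLinearMap.adjoint f ξ⟫_ℂ + ⟪η, S₂ η⟫_ℂ

/-- The decomposable seminorm `‖f‖_{p,dec}`. -/
def decNorm (ν : POVM X H) (ρ : State H) (p : ℝ≥0∞) (f : X → (H →L[ℂ] H)) : ℝ≥0∞ :=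
  ⨅ S ∈ {S : (X → (H →L[ℂ] H)) × (X → (H →L[ℂ] H)) |
      (S.1 ∈ qrvSpan X H ∧ ∀ x, 0 ≤ S.1 x) ∧ (S.2 ∈ qrvSpan X H ∧ ∀ x, 0 ≤ S.2 x) ∧
      ∀ᵐ x ∂(ν.stateMeasure ρ), BlockNonneg (S.1 x) (f x) (S.2 x)},
    max (pNorm ν ρ p S.1) (pNorm ν ρ p S.2)

/-- The essential supremum `‖g‖_∞` of the operator norm. -/
def supNorm (ν : POVM X H) (ρ : State H) (g : X → (H →L[ℂ] H)) : ℝ≥0∞ :=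
  essSup (fun x => ‖g x‖ₑ) (ν.stateMeasure ρ)

/-- Essentially bounded quantum random variables. -/
def MemLinfOp (ν : POVM X H) (ρ : State H) (g : X → (H →L[ℂ] H)) : Prop :=
  IsQRV g ∧ supNorm ν ρ g < ∞

end Measures

section Tensor

/-- The Hilbert space tensor product. -/
abbrev HTensor (H K : Type*) [NormedAddCommGroup H] [InnerProductSpace ℂ H]
    [NormedAddCommGroup K] [InnerProductSpace ℂ K] : Type _ :=
  UniformSpace.Completion (H ⊗[ℂ] K)

variable {X : Type*} [MeasurableSpace X]
variable {H : Type*} [NormedAddCommGroup H] [InnerProductSpace ℂ H]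
variable {K : Type*} [NormedAddCommGroup K] [InnerProductSpace ℂ K]

/-- The tensor product `A ⊗ B` of bounded operators on the Hilbert space tensor product. -/
def opTensor (A : H →L[ℂ] H) (B : K →L[ℂ] K) : HTensor H K →L[ℂ] HTensor H K :=
  (TensorProduct.mapL A B).completion

/-- The pointwise tensor product of operator-valued functions. -/
def funTensor (f : X → (H →L[ℂ] H)) (g : X → (K →L[ℂ] K)) (x : X) :
    HTensor H K →L[ℂ] HTensor H K :=
  opTensor (f x) (g x)

/-- `τ` is the POVM `ν₁ ⊗_μ ν₂`, i.e. `τ(E) = ∫_E (dν₁/dμ ⊗ dν₂/dμ) dμ I`, the integral being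
defined by pairing with all density operators. -/
def IsTensorPOVM [CompleteSpace H] [CompleteSpace K] (ν₁ : POVM X H) (ν₂ : POVM X K)
    (μ : Measure X) (τ : POVM X (HTensor H K)) : Prop :=
  ∀ s : State (HTensor H K),
    Integrable (fun x => trace (s.op * funTensor (rnDeriv ν₁ μ) (rnDeriv ν₂ μ) x)) μ ∧
    ∀ E, MeasurableSet E → trace (s.op * τ.toFun E) =
      ∫ x in E, trace (s.op * funTensor (rnDeriv ν₁ μ) (rnDeriv ν₂ μ) x) ∂μ

end Tensor

end QRV

end

/-!
Write `D = dν/dμ` and `D' = dν'/dμ` with `μ = ν_ρ`. The function `D ⊗ D'` is bounded and almost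
everywhere positive, so it is the weak density of a POVM `τ`. For a full-rank state `σ` the scalar
`h = tr (σ (D ⊗ D'))` is the density of `τ_σ` with respect to `μ`, and `dτ/dτ_σ = h⁻¹ (D ⊗ D')`.
The factor `h` cancels from the slices: `∫ F_s dτ_σ = ∫ tr (s (√D ⊗ √D') F (√D ⊗ √D')) dμ`.

For positive `F = f ⊗ g` the integrand is `tr (s (√D f √D ⊗ √D' g √D'))`. Positivity of the
second factor bounds it by `‖D'‖ ‖g‖ tr (s₁ √D f √D)`, where the state `s₁` is the partial trace
of `s`. Hence `‖f ⊗ g‖₁ ≤ ‖D'‖_∞ ‖f‖₁ ‖g‖_∞` for positive `g`. The constant `2` in general comes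
from writing `g` as a combination `g₁ - g₂ + i g₃ - i g₄` of positive functions whose sum is a
scalar function bounded by `2 ‖g‖`. For the decomposable norm, conjugating the block matrix of `f`
by `1 ⊗ g` shows that the functions `S_k ⊗ ‖g‖` dominate `f ⊗ g`, without a decomposition of `g`.
-/

noncomputable section

namespace QRV

section States

variable {H : Type*} [NormedAddCommGroup H] [InnerProductSpace ℂ H]

theorem inner_self_eq_ofReal (x : H) : ⟪x, x⟫_ℂ = ((‖x‖ ^ 2 : ℝ) : ℂ) := by
  rw [inner_self_eq_norm_sq_to_K]
  norm_cast

theorem summable_norm_sq_apply {ι : Type*} {u : ι → H} (hu : Summable fun i => ‖u i‖ ^ 2)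
    (A : H →L[ℂ] H) : Summable fun i => ‖A (u i)‖ ^ 2 := by
  refine Summable.of_nonneg_of_le (fun i => by positivity) (fun i => ?_) (hu.mul_left (‖A‖ ^ 2))
  rw [← mul_pow]
  gcongr
  exact A.le_opNorm _

/-- The frame operator `∑ᵢ |uᵢ⟩⟨uᵢ|` of a family of vectors. It is meant for square summable
families; the value is `0` if the sum diverges. -/
def frameOperator {ι : Type*} (u : ι → H) : H →L[ℂ] H :=
  ∑' i, InnerProductSpace.rankOne ℂ (u i) (u i)

variable [CompleteSpace H]

theorem hasSum_inner_frameOperator {ι : Type*} {u : ι → H} (hu : Summable fun i => ‖u i‖ ^ 2)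
    (x y : H) : HasSum (fun i => ⟪x, u i⟫_ℂ * ⟪u i, y⟫_ℂ) ⟪x, frameOperator u y⟫_ℂ := by
  have hs : Summable fun i => InnerProductSpace.rankOne ℂ (u i) (u i) :=
    hu.of_norm_bounded fun i => by rw [InnerProductSpace.norm_rankOne, sq]
  have h := (hs.hasSum.mapL (ContinuousLinearMap.apply ℂ H y)).mapL (innerSL ℂ x)
  simpa [frameOperator, InnerProductSpace.rankOne_apply, inner_smul_right, mul_comm] using h

theorem frameOperator_nonneg {ι : Type*} (u : ι → H) : 0 ≤ frameOperator u :=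
  tsum_nonneg fun _ => (ContinuousLinearMap.nonneg_iff_isPositive _).2
    (InnerProductSpace.isPositive_rankOne_self _)

theorem summable_norm_sq_inner_basis {ι : Type*} {u : ι → H} (hu : Summable fun i => ‖u i‖ ^ 2) :
    Summable fun p : ι × basisIndex H => ‖⟪basis H p.2, u p.1⟫_ℂ‖ ^ 2 := by
  rw [summable_prod_of_nonneg fun p => by positivity]
  refine ⟨fun i => (hasSum_norm_inner_sq (u i)).summable, ?_⟩
  simpa only [(hasSum_norm_inner_sq (u _)).tsum_eq] using hu

theorem summable_inner_mul_inner {ι : Type*} {u v : ι → H} (hu : Summable fun i => ‖u i‖ ^ 2)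
    (hv : Summable fun i => ‖v i‖ ^ 2) :
    Summable fun p : ι × basisIndex H =>
      ⟪u p.1, basis H p.2⟫_ℂ * ⟪basis H p.2, v p.1⟫_ℂ := by
  refine ((summable_norm_sq_inner_basis hu).add (summable_norm_sq_inner_basis hv)).of_norm_bounded
    fun p => ?_
  rw [norm_mul, norm_inner_symm]
  nlinarith [two_mul_le_add_sq ‖⟪basis H p.2, u p.1⟫_ℂ‖ ‖⟪basis H p.2, v p.1⟫_ℂ‖,
    norm_nonneg ⟪basis H p.2, u p.1⟫_ℂ, norm_nonneg ⟪basis H p.2, v p.1⟫_ℂ,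
    mul_nonneg (norm_nonneg ⟪basis H p.2, u p.1⟫_ℂ) (norm_nonneg ⟪basis H p.2, v p.1⟫_ℂ)]

theorem hasSum_inner_map_trace {ι : Type*} {u : ι → H} (hu : Summable fun i => ‖u i‖ ^ 2)
    (A : H →L[ℂ] H) : HasSum (fun i => ⟪u i, A (u i)⟫_ℂ) (trace (frameOperator u * A)) := by
  have hsum := summable_inner_mul_inner
    (summable_norm_sq_apply hu (ContinuousLinearMap.adjoint A)) hu
  have hrow : ∀ i, HasSum (fun k => ⟪ContinuousLinearMap.adjoint A (u i), basis H k⟫_ℂ *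
      ⟪basis H k, u i⟫_ℂ) ⟪u i, A (u i)⟫_ℂ := fun i => by
    rw [← ContinuousLinearMap.adjoint_inner_left]
    exact (basis H).hasSum_inner_mul_inner _ _
  have hcol : ∀ k, HasSum (fun i => ⟪ContinuousLinearMap.adjoint A (u i), basis H k⟫_ℂ *
      ⟪basis H k, u i⟫_ℂ) ⟪basis H k, (frameOperator u * A) (basis H k)⟫_ℂ := fun k => by
    simpa only [ContinuousLinearMap.adjoint_inner_left, mul_apply_eq_comp,
      mul_comm ⟪_, A _⟫_ℂ] using hasSum_inner_frameOperator hu (basis H k) (A (basis H k))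
  have hiterate : trace (frameOperator u * A) = ∑' p : ι × basisIndex H,
      ⟪ContinuousLinearMap.adjoint A (u p.1), basis H p.2⟫_ℂ * ⟪basis H p.2, u p.1⟫_ℂ :=
    (((Equiv.prodComm (basisIndex H) ι).hasSum_iff.2 hsum.hasSum).prod_fiberwise hcol).tsum_eq
  rw [hiterate]
  exact hsum.hasSum.prod_fiberwise hrow

/-- The density operator `∑ᵢ |uᵢ⟩⟨uᵢ|` of a family with `∑ᵢ ‖uᵢ‖² = 1`: a convex combination of
vector states. -/
def State.ofVectors {ι : Type*} (u : ι → H) (hu : HasSum (fun i => ‖u i‖ ^ 2) 1) : State H :=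
  ⟨frameOperator u, frameOperator_nonneg u, by
    have h := hasSum_inner_map_trace hu.summable 1
    simp only [mul_one, one_apply_eq_self, inner_self_eq_ofReal] at h
    exact h.unique (by simpa using (Complex.hasSum_ofReal (f := fun i => ‖u i‖ ^ 2)).2 hu)⟩

theorem State.hasSum_trace_ofVectors {ι : Type*} {u : ι → H}
    (hu : HasSum (fun i => ‖u i‖ ^ 2) 1) (A : H →L[ℂ] H) :
    HasSum (fun i => ⟪u i, A (u i)⟫_ℂ) (trace ((State.ofVectors u hu).op * A)) :=
  hasSum_inner_map_trace hu.summable A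

/-- The vectors `√s eⱼ`, whose frame operator is `s`. -/
def State.sqrtVectors (s : State H) (j : basisIndex H) : H :=
  CFC.sqrt s.op (basis H j)

theorem State.op_nonneg (s : State H) : 0 ≤ s.op := s.2.1

theorem isSelfAdjoint_sqrt (A : H →L[ℂ] H) : IsSelfAdjoint (CFC.sqrt A) :=
  IsSelfAdjoint.of_nonneg (CFC.sqrt_nonneg A)

theorem inner_sqrt_left (A : H →L[ℂ] H) (x y : H) :
    ⟪CFC.sqrt A x, y⟫_ℂ = ⟪x, CFC.sqrt A y⟫_ℂ :=
  (isSelfAdjoint_sqrt A).isSymmetric x y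

theorem inner_map_eq_inner_sqrt {A : H →L[ℂ] H} (hA : 0 ≤ A) (x y : H) :
    ⟪x, A y⟫_ℂ = ⟪CFC.sqrt A x, CFC.sqrt A y⟫_ℂ := by
  rw [inner_sqrt_left, ← mul_apply_eq_comp, CFC.sqrt_mul_sqrt_self A hA]

theorem State.hasSum_norm_sq_sqrtVectors (s : State H) :
    HasSum (fun j => ‖s.sqrtVectors j‖ ^ 2) 1 := by
  have hsum : Summable fun i => ⟪basis H i, s.op (basis H i)⟫_ℂ := by
    by_contra h
    exact zero_ne_one ((tsum_eq_zero_of_not_summable h).symm.trans s.2.2)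
  have h := hsum.hasSum
  rw [show ∑' i, ⟪basis H i, s.op (basis H i)⟫_ℂ = ((1 : ℝ) : ℂ) from
    s.2.2.trans Complex.ofReal_one.symm] at h
  simpa only [State.sqrtVectors, inner_map_eq_inner_sqrt s.op_nonneg, inner_self_eq_ofReal,
    Complex.hasSum_ofReal] using h

theorem State.frameOperator_sqrtVectors (s : State H) : frameOperator s.sqrtVectors = s.op := by
  refine ContinuousLinearMap.ext fun y => ext_inner_left ℂ fun x => ?_
  refine (hasSum_inner_frameOperator s.hasSum_norm_sq_sqrtVectors.summable x y).unique ?_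
  rw [inner_map_eq_inner_sqrt s.op_nonneg]
  simpa only [State.sqrtVectors, inner_sqrt_left] using
    (basis H).hasSum_inner_mul_inner (CFC.sqrt s.op x) (CFC.sqrt s.op y)

theorem State.hasSum_trace (s : State H) (A : H →L[ℂ] H) :
    HasSum (fun j => ⟪s.sqrtVectors j, A (s.sqrtVectors j)⟫_ℂ) (trace (s.op * A)) := by
  simpa only [s.frameOperator_sqrtVectors] using
    hasSum_inner_map_trace s.hasSum_norm_sq_sqrtVectors.summable A

theorem State.norm_trace_mul_le (s : State H) (A : H →L[ℂ] H) : ‖trace (s.op * A)‖ ≤ ‖A‖ := by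
  have hbound : HasSum (fun j => ‖A‖ * ‖s.sqrtVectors j‖ ^ 2) ‖A‖ := by
    simpa using s.hasSum_norm_sq_sqrtVectors.mul_left ‖A‖
  rw [← (s.hasSum_trace A).tsum_eq]
  refine tsum_of_norm_bounded hbound fun j => ?_
  calc ‖⟪s.sqrtVectors j, A (s.sqrtVectors j)⟫_ℂ‖
      ≤ ‖s.sqrtVectors j‖ * ‖A (s.sqrtVectors j)‖ := norm_inner_le_norm _ _
    _ ≤ ‖s.sqrtVectors j‖ * (‖A‖ * ‖s.sqrtVectors j‖) := by gcongr; exact A.le_opNorm _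
    _ = ‖A‖ * ‖s.sqrtVectors j‖ ^ 2 := by ring

theorem State.trace_mul_add (s : State H) (A B : H →L[ℂ] H) :
    trace (s.op * (A + B)) = trace (s.op * A) + trace (s.op * B) := by
  refine (s.hasSum_trace _).unique ?_
  simpa [inner_add_right] using (s.hasSum_trace A).add (s.hasSum_trace B)

theorem State.trace_mul_smul (s : State H) (c : ℂ) (A : H →L[ℂ] H) :
    trace (s.op * (c • A)) = c * trace (s.op * A) := by
  refine (s.hasSum_trace _).unique ?_
  simpa [inner_smul_right] using (s.hasSum_trace A).mul_left c

theorem State.trace_mul_mono (s : State H) {A B : H →L[ℂ] H} (h : A ≤ B) :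
    trace (s.op * A) ≤ trace (s.op * B) := by
  rw [← add_sub_cancel A B, s.trace_mul_add]
  exact le_add_of_nonneg_right (trace_mul_nonneg s (sub_nonneg.2 h))

theorem State.FullRank.eq_zero_of_trace_mul_eq_zero {s : State H} (hs : s.FullRank)
    {A : H →L[ℂ] H} (hA : 0 ≤ A) (h : trace (s.op * A) = 0) : A = 0 := by
  have hvec : ∀ j, A (s.sqrtVectors j) = 0 := fun j => by
    have hsum := s.hasSum_trace A
    rw [h, hasSum_zero_iff_of_nonneg fun j =>
      ((ContinuousLinearMap.nonneg_iff_isPositive A).1 hA).inner_nonneg_right _] at hsum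
    have hj := congrFun hsum j
    rw [inner_map_eq_inner_sqrt hA, Pi.zero_apply, inner_self_eq_zero] at hj
    rw [← CFC.sqrt_mul_sqrt_self A hA, mul_apply_eq_comp, hj, map_zero]
  have hframe : ∀ y, s.op (A y) = 0 := fun y => by
    refine ext_inner_left ℂ fun x => ?_
    rw [← s.frameOperator_sqrtVectors, inner_zero_right]
    refine (hasSum_inner_frameOperator s.hasSum_norm_sq_sqrtVectors.summable x (A y)).unique ?_
    have hterm : ∀ j, ⟪s.sqrtVectors j, A y⟫_ℂ = 0 := fun j => by
      rw [← (IsSelfAdjoint.of_nonneg hA).isSymmetric.apply_clm, hvec j, inner_zero_left]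
    simpa only [hterm, mul_zero] using hasSum_zero
  exact ContinuousLinearMap.ext fun y => hs (by rw [hframe y]; simp)

/-- The vector state `A ↦ ⟪u, A u⟫` of a unit vector `u`. -/
def State.ofUnitVector (u : H) (hu : ‖u‖ = 1) : State H :=
  State.ofVectors (fun _ : Unit => u) (by simp [hu])

theorem State.trace_ofUnitVector {u : H} (hu : ‖u‖ = 1) (A : H →L[ℂ] H) :
    trace ((State.ofUnitVector u hu).op * A) = ⟪u, A u⟫_ℂ :=
  (State.hasSum_trace_ofVectors _ A).unique (hasSum_unique fun _ : Unit => ⟪u, A u⟫_ℂ)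

/-- The normal functionals on `B(H)`: the complex linear combinations of the functionals
`A ↦ tr (s A)` with `s` a density operator. -/
def normalFunctional (H : Type*) [NormedAddCommGroup H] [InnerProductSpace ℂ H]
    [CompleteSpace H] : Submodule ℂ ((H →L[ℂ] H) → ℂ) :=
  Submodule.span ℂ (Set.range fun (s : State H) A => trace (s.op * A))

theorem inner_map_self_mem_normalFunctional (ξ : H) :
    (fun A : H →L[ℂ] H => ⟪ξ, A ξ⟫_ℂ) ∈ normalFunctional H := by
  rcases eq_or_ne ξ 0 with rfl | hξ
  · simp only [inner_zero_left]
    exact (normalFunctional H).zero_mem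
  have hu : ‖((‖ξ‖⁻¹ : ℝ) : ℂ) • ξ‖ = 1 := by
    simp [norm_smul, inv_mul_cancel₀ (norm_ne_zero_iff.2 hξ)]
  have hmem := (normalFunctional H).smul_mem ((‖ξ‖ : ℂ) ^ 2)
    (Submodule.subset_span (Set.mem_range_self (State.ofUnitVector _ hu)))
  convert hmem using 1
  funext A
  have hnorm : (‖ξ‖ : ℂ) ≠ 0 := by simpa using hξ
  simp only [State.trace_ofUnitVector, Pi.smul_apply, map_smul, inner_smul_left, inner_smul_right,
    smul_eq_mul, Complex.conj_ofReal]
  rw [Complex.ofReal_inv]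
  field_simp

theorem inner_map_mem_normalFunctional (ξ η : H) :
    (fun A : H →L[ℂ] H => ⟪ξ, A η⟫_ℂ) ∈ normalFunctional H := by
  have hpol : (fun A : H →L[ℂ] H => ⟪ξ, A η⟫_ℂ) = (1 / 4 : ℂ) •
      ((fun A : H →L[ℂ] H => ⟪η + ξ, A (η + ξ)⟫_ℂ) - (fun A => ⟪η - ξ, A (η - ξ)⟫_ℂ) +
        Complex.I • (fun A => ⟪η + Complex.I • ξ, A (η + Complex.I • ξ)⟫_ℂ) -
        Complex.I • (fun A => ⟪η - Complex.I • ξ, A (η - Complex.I • ξ)⟫_ℂ)) := by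
    funext A
    simp only [Pi.smul_apply, Pi.add_apply, Pi.sub_apply, map_add, map_sub, map_smul,
      inner_add_left, inner_add_right, inner_sub_left, inner_sub_right, inner_smul_left,
      inner_smul_right, Complex.conj_I, smul_eq_mul]
    ring_nf
    simp only [Complex.I_sq]
    ring
  have hmem := inner_map_self_mem_normalFunctional (H := H)
  rw [hpol]
  exact Submodule.smul_mem _ _ (sub_mem (add_mem (sub_mem (hmem _) (hmem _))
    (Submodule.smul_mem _ _ (hmem _))) (Submodule.smul_mem _ _ (hmem _)))

end States

section TensorOperators

variable {H : Type*} [NormedAddCommGroup H] [InnerProductSpace ℂ H]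
variable {K : Type*} [NormedAddCommGroup K] [InnerProductSpace ℂ K]

/-- The elementary tensors `a ⊗ b` of the Hilbert space tensor product, as a bounded bilinear
map. -/
def HTensor.tmul : H →L[ℂ] K →L[ℂ] HTensor H K :=
  (ContinuousLinearMap.compL ℂ K (H ⊗[ℂ] K) (HTensor H K) UniformSpace.Completion.toComplL).comp
    (TensorProduct.mkL ℂ H K)

theorem HTensor.inner_tmul (a a' : H) (b b' : K) :
    ⟪HTensor.tmul a b, HTensor.tmul a' b'⟫_ℂ = ⟪a, a'⟫_ℂ * ⟪b, b'⟫_ℂ :=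
  (UniformSpace.Completion.inner_coe _ _).trans (TensorProduct.inner_tmul (𝕜 := ℂ) a a' b b')

theorem HTensor.clm_ext {F : Type*} [NormedAddCommGroup F] [NormedSpace ℂ F]
    {A B : HTensor H K →L[ℂ] F}
    (h : ∀ a b, A (HTensor.tmul a b) = B (HTensor.tmul a b)) : A = B := by
  ext w
  induction w using UniformSpace.Completion.induction_on with
  | hp => exact isClosed_eq A.continuous B.continuous
  | ih t =>
    induction t using TensorProduct.induction_on with
    | zero => rw [UniformSpace.Completion.coe_zero, map_zero, map_zero]
    | tmul a b => exact h a b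
    | add x y hx hy => rw [UniformSpace.Completion.coe_add, map_add, map_add, hx, hy]

theorem HTensor.ext_inner {w z : HTensor H K}
    (h : ∀ a b, ⟪w, HTensor.tmul a b⟫_ℂ = ⟪z, HTensor.tmul a b⟫_ℂ) : w = z :=
  ext_inner_right ℂ (DFunLike.congr_fun (HTensor.clm_ext h : innerSL ℂ w = innerSL ℂ z))

@[simp]
theorem opTensor_tmul (A : H →L[ℂ] H) (B : K →L[ℂ] K) (a : H) (b : K) :
    opTensor A B (HTensor.tmul a b) = HTensor.tmul (A a) (B b) :=
  ContinuousLinearMap.completion_apply_coe _ _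

/-- `opTensor` as a bilinear map. -/
def opTensorₗ : (H →L[ℂ] H) →ₗ[ℂ] (K →L[ℂ] K) →ₗ[ℂ] (HTensor H K →L[ℂ] HTensor H K) :=
  LinearMap.mk₂ ℂ opTensor
    (fun _ _ _ => HTensor.clm_ext fun a b => by simp)
    (fun _ _ _ => HTensor.clm_ext fun a b => by simp)
    (fun _ _ _ => HTensor.clm_ext fun a b => by simp)
    (fun _ _ _ => HTensor.clm_ext fun a b => by simp)

theorem opTensor_add_left (A A' : H →L[ℂ] H) (B : K →L[ℂ] K) :
    opTensor (A + A') B = opTensor A B + opTensor A' B :=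
  opTensorₗ.map_add₂ A A' B

theorem opTensor_add_right (A : H →L[ℂ] H) (B B' : K →L[ℂ] K) :
    opTensor A (B + B') = opTensor A B + opTensor A B' :=
  (opTensorₗ A).map_add B B'

theorem opTensor_sub_left (A A' : H →L[ℂ] H) (B : K →L[ℂ] K) :
    opTensor (A - A') B = opTensor A B - opTensor A' B :=
  opTensorₗ.map_sub₂ A A' B

theorem opTensor_sub_right (A : H →L[ℂ] H) (B B' : K →L[ℂ] K) :
    opTensor A (B - B') = opTensor A B - opTensor A B' :=
  (opTensorₗ A).map_sub B B'

theorem opTensor_smul_left (c : ℂ) (A : H →L[ℂ] H) (B : K →L[ℂ] K) :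
    opTensor (c • A) B = c • opTensor A B :=
  opTensorₗ.map_smul₂ c A B

theorem opTensor_smul_right (c : ℂ) (A : H →L[ℂ] H) (B : K →L[ℂ] K) :
    opTensor A (c • B) = c • opTensor A B :=
  (opTensorₗ A).map_smul c B

theorem opTensor_zero_right (A : H →L[ℂ] H) : opTensor A (0 : K →L[ℂ] K) = 0 :=
  (opTensorₗ A).map_zero

theorem opTensor_mul (A A' : H →L[ℂ] H) (B B' : K →L[ℂ] K) :
    opTensor (A * A') (B * B') = opTensor A B * opTensor A' B' :=
  HTensor.clm_ext fun a b => by simp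

theorem norm_opTensor_le (A : H →L[ℂ] H) (B : K →L[ℂ] K) : ‖opTensor A B‖ ≤ ‖A‖ * ‖B‖ := by
  refine ContinuousLinearMap.opNorm_le_bound _ (by positivity) fun w => ?_
  induction w using UniformSpace.Completion.induction_on with
  | hp => exact isClosed_le (by fun_prop) (by fun_prop)
  | ih t =>
    rw [opTensor, ContinuousLinearMap.completion_apply_coe, UniformSpace.Completion.norm_coe,
      UniformSpace.Completion.norm_coe]
    exact (ContinuousLinearMap.le_opNorm _ _).trans
      (mul_le_mul_of_nonneg_right (TensorProduct.norm_mapL_le A B) (norm_nonneg _))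

theorem adjoint_opTensor [CompleteSpace H] [CompleteSpace K] (A : H →L[ℂ] H) (B : K →L[ℂ] K) :
    ContinuousLinearMap.adjoint (opTensor A B) =
      opTensor (ContinuousLinearMap.adjoint A) (ContinuousLinearMap.adjoint B) := by
  refine HTensor.clm_ext fun a b => HTensor.ext_inner fun a' b' => ?_
  simp only [ContinuousLinearMap.adjoint_inner_left, opTensor_tmul, HTensor.inner_tmul]

theorem opTensor_nonneg [CompleteSpace H] [CompleteSpace K] {A : H →L[ℂ] H} {B : K →L[ℂ] K}
    (hA : 0 ≤ A) (hB : 0 ≤ B) : 0 ≤ opTensor A B := by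
  have hsquare : opTensor A B = star (opTensor (CFC.sqrt A) (CFC.sqrt B)) *
      opTensor (CFC.sqrt A) (CFC.sqrt B) := by
    rw [ContinuousLinearMap.star_eq_adjoint, adjoint_opTensor,
      (isSelfAdjoint_sqrt A).adjoint_eq, (isSelfAdjoint_sqrt B).adjoint_eq,
      ← opTensor_mul, CFC.sqrt_mul_sqrt_self A hA, CFC.sqrt_mul_sqrt_self B hB]
  rw [hsquare]
  exact star_mul_self_nonneg (opTensor (CFC.sqrt A) (CFC.sqrt B))

theorem opTensor_le_opTensor_right [CompleteSpace H] [CompleteSpace K] {A : H →L[ℂ] H}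
    (hA : 0 ≤ A) {B B' : K →L[ℂ] K} (h : B ≤ B') : opTensor A B ≤ opTensor A B' := by
  rw [← sub_nonneg, ← opTensor_sub_right]
  exact opTensor_nonneg hA (sub_nonneg.2 h)

end TensorOperators

section PartialTrace

variable {H : Type*} [NormedAddCommGroup H] [InnerProductSpace ℂ H] [CompleteSpace H]
variable {K : Type*} [NormedAddCommGroup K] [InnerProductSpace ℂ K]

/-- The contraction `w ↦ (1 ⊗ ⟨e|) w` of the second tensor factor against a vector `e`, i.e. the
adjoint of `a ↦ a ⊗ e`. -/
def contractRight (e : K) : HTensor H K →L[ℂ] H :=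
  ContinuousLinearMap.adjoint (HTensor.tmul.flip e)

theorem inner_contractRight (e : K) (a : H) (w : HTensor H K) :
    ⟪a, contractRight e w⟫_ℂ = ⟪HTensor.tmul a e, w⟫_ℂ :=
  ContinuousLinearMap.adjoint_inner_right _ a w

theorem contractRight_tmul (e : K) (a : H) (b : K) :
    contractRight e (HTensor.tmul a b) = ⟪e, b⟫_ℂ • a :=
  ext_inner_left ℂ fun x => by
    rw [inner_contractRight, HTensor.inner_tmul, inner_smul_right, mul_comm]

theorem contractRight_opTensor_one (e : K) (A : H →L[ℂ] H) (w : HTensor H K) :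
    contractRight e (opTensor A 1 w) = A (contractRight e w) :=
  DFunLike.congr_fun (HTensor.clm_ext (A := (contractRight e).comp (opTensor A 1))
    (B := A.comp (contractRight e)) fun a b => by simp [contractRight_tmul]) w

theorem hilbertBasis_ext {E ι : Type*} [NormedAddCommGroup E] [InnerProductSpace ℂ E]
    (b : HilbertBasis ι ℂ E) {x y : E} (h : ∀ i, ⟪b i, x⟫_ℂ = ⟪b i, y⟫_ℂ) : x = y :=
  b.repr.injective <| lp.ext <| funext fun i => by
    rw [b.repr_apply_apply, b.repr_apply_apply, h i]

variable [CompleteSpace K]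

theorem orthonormal_tmul_basis :
    Orthonormal ℂ fun p : basisIndex K × basisIndex H =>
      HTensor.tmul (basis H p.2) (basis K p.1) := by
  classical
  rw [orthonormal_iff_ite]
  rintro ⟨j, i⟩ ⟨j', i'⟩
  rw [HTensor.inner_tmul, orthonormal_iff_ite.1 (basis H).orthonormal,
    orthonormal_iff_ite.1 (basis K).orthonormal]
  by_cases hi : i = i' <;> by_cases hj : j = j' <;> simp [hi, hj]

theorem eq_zero_of_inner_tmul_basis_eq_zero {w : HTensor H K}
    (h : ∀ i j, ⟪HTensor.tmul (basis H i) (basis K j), w⟫_ℂ = 0) : w = 0 := by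
  have hright : ∀ a j, ⟪HTensor.tmul a (basis K j), w⟫_ℂ = 0 := fun a j => by
    have hzero : contractRight (basis K j) w = 0 := hilbertBasis_ext (basis H) fun i => by
      rw [inner_contractRight, h, inner_zero_right]
    rw [← inner_contractRight, hzero, inner_zero_right]
  refine HTensor.ext_inner fun a b => ?_
  have hzero : ContinuousLinearMap.adjoint (HTensor.tmul a) w = 0 :=
    hilbertBasis_ext (basis K) fun j => by
      rw [ContinuousLinearMap.adjoint_inner_right, hright, inner_zero_right]
  rw [← ContinuousLinearMap.adjoint_inner_left, hzero, inner_zero_left, inner_zero_left]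

/-- The Hilbert basis `eᵢ ⊗ e'ⱼ` of the tensor product. The index of the second factor comes
first, so that summation by fibres sums over the first factor. -/
def tensorBasis (H K : Type*) [NormedAddCommGroup H] [InnerProductSpace ℂ H] [CompleteSpace H]
    [NormedAddCommGroup K] [InnerProductSpace ℂ K] [CompleteSpace K] :
    HilbertBasis (basisIndex K × basisIndex H) ℂ (HTensor H K) :=
  HilbertBasis.mkOfOrthogonalEqBot orthonormal_tmul_basis <| by
    rw [Submodule.eq_bot_iff]
    exact fun w hw => eq_zero_of_inner_tmul_basis_eq_zero fun i j =>
      (Submodule.mem_orthogonal _ w).1 hw _ (Submodule.subset_span ⟨(j, i), rfl⟩)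

theorem tensorBasis_apply (p : basisIndex K × basisIndex H) :
    tensorBasis H K p = HTensor.tmul (basis H p.2) (basis K p.1) := by
  rw [tensorBasis, HilbertBasis.coe_mkOfOrthogonalEqBot]

theorem hasSum_inner_contractRight (w z : HTensor H K) :
    HasSum (fun j => ⟪contractRight (basis K j) w, contractRight (basis K j) z⟫_ℂ) ⟪w, z⟫_ℂ := by
  refine ((tensorBasis H K).hasSum_inner_mul_inner w z).prod_fiberwise fun j => ?_
  have h := (basis H).hasSum_inner_mul_inner (contractRight (basis K j) w)
    (contractRight (basis K j) z)
  simpa only [inner_contractRight, tensorBasis_apply, ← inner_conj_symm (contractRight _ w),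
    ← inner_conj_symm w] using h

theorem hasSum_inner_map_contractRight (A : H →L[ℂ] H) (w z : HTensor H K) :
    HasSum (fun j => ⟪contractRight (basis K j) w, A (contractRight (basis K j) z)⟫_ℂ)
      ⟪w, opTensor A 1 z⟫_ℂ := by
  simpa only [contractRight_opTensor_one] using hasSum_inner_contractRight w (opTensor A 1 z)

theorem hasSum_norm_sq_contractRight (w : HTensor H K) :
    HasSum (fun j => ‖contractRight (H := H) (basis K j) w‖ ^ 2) (‖w‖ ^ 2) := by
  simpa only [inner_self_eq_ofReal, Complex.hasSum_ofReal] using hasSum_inner_contractRight w w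

theorem State.hasSum_norm_sq_contractRight (s : State (HTensor H K)) :
    HasSum (fun p : basisIndex (HTensor H K) × basisIndex K =>
      ‖contractRight (H := H) (basis K p.2) (s.sqrtVectors p.1)‖ ^ 2) 1 := by
  have hfibre := fun m => QRV.hasSum_norm_sq_contractRight (H := H) (K := K) (s.sqrtVectors m)
  have hsum : Summable fun p : basisIndex (HTensor H K) × basisIndex K =>
      ‖contractRight (H := H) (basis K p.2) (s.sqrtVectors p.1)‖ ^ 2 := by
    rw [summable_prod_of_nonneg fun p => by positivity]
    refine ⟨fun m => (hfibre m).summable, ?_⟩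
    simpa only [(hfibre _).tsum_eq] using s.hasSum_norm_sq_sqrtVectors.summable
  rw [← (hsum.hasSum.prod_fiberwise hfibre).unique s.hasSum_norm_sq_sqrtVectors]
  exact hsum.hasSum

/-- The partial trace of a density operator over the second tensor factor. -/
def State.partialTrace (s : State (HTensor H K)) : State H :=
  State.ofVectors _ s.hasSum_norm_sq_contractRight

theorem State.trace_partialTrace_mul (s : State (HTensor H K)) (A : H →L[ℂ] H) :
    trace (s.partialTrace.op * A) = trace (s.op * opTensor A 1) :=
  ((State.hasSum_trace_ofVectors s.hasSum_norm_sq_contractRight A).prod_fiberwise fun m =>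
    hasSum_inner_map_contractRight A (s.sqrtVectors m) (s.sqrtVectors m)).unique (s.hasSum_trace _)

theorem State.norm_trace_opTensor_le (s : State (HTensor H K)) {A : H →L[ℂ] H} {B : K →L[ℂ] K}
    (hA : 0 ≤ A) (hB : 0 ≤ B) :
    ‖trace (s.op * opTensor A B)‖ ≤ ‖B‖ * ‖trace (s.partialTrace.op * A)‖ := by
  have hB_le : B ≤ (‖B‖ : ℂ) • 1 := by
    simpa [Algebra.algebraMap_eq_smul_one] using
      (IsSelfAdjoint.of_nonneg hB).le_algebraMap_norm_self
  calc ‖trace (s.op * opTensor A B)‖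
      ≤ ‖trace (s.op * opTensor A ((‖B‖ : ℂ) • (1 : K →L[ℂ] K)))‖ :=
        CStarAlgebra.norm_le_norm_of_nonneg_of_le (trace_mul_nonneg s (opTensor_nonneg hA hB))
          (s.trace_mul_mono (opTensor_le_opTensor_right hA hB_le))
    _ = ‖B‖ * ‖trace (s.partialTrace.op * A)‖ := by
        rw [opTensor_smul_right, s.trace_mul_smul, ← s.trace_partialTrace_mul, norm_mul,
          Complex.norm_real, norm_norm]

end PartialTrace

section Separability

variable {H : Type*} [NormedAddCommGroup H] [InnerProductSpace ℂ H]

theorem separableSpace_of_hilbertBasis {ι : Type*} [Countable ι] (b : HilbertBasis ι ℂ H) :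
    TopologicalSpace.SeparableSpace H := by
  have hspan : TopologicalSpace.IsSeparable (Submodule.span ℂ (Set.range b) : Set H) :=
    (Set.countable_range b).isSeparable.span
  rw [← TopologicalSpace.isSeparable_univ_iff]
  simpa only [← Submodule.topologicalClosure_coe, b.dense_span, Submodule.top_coe] using
    hspan.closure

theorem countable_of_orthonormal [TopologicalSpace.SeparableSpace H] {ι : Type*} {v : ι → H}
    (hv : Orthonormal ℂ v) : Countable ι := by
  refine Pairwise.countable_of_isOpen_disjoint (s := fun i => Metric.ball (v i) (1 / 2))
    (fun i j hij => Metric.ball_disjoint_ball ?_)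
    (fun i => Metric.isOpen_ball) (fun i => ⟨_, Metric.mem_ball_self (by norm_num)⟩)
  have hdist : ‖v i - v j‖ ^ 2 = 2 := by
    rw [@norm_sub_sq ℂ, hv.1 i, hv.1 j, hv.2 hij]
    norm_num
  rw [dist_eq_norm]
  nlinarith [norm_nonneg (v i - v j)]

instance countable_basisIndex [CompleteSpace H] [TopologicalSpace.SeparableSpace H] :
    Countable (basisIndex H) :=
  countable_of_orthonormal (basis H).orthonormal

instance HTensor.separableSpace [CompleteSpace H] [TopologicalSpace.SeparableSpace H]
    {K : Type*} [NormedAddCommGroup K] [InnerProductSpace ℂ K] [CompleteSpace K]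
    [TopologicalSpace.SeparableSpace K] : TopologicalSpace.SeparableSpace (HTensor H K) :=
  separableSpace_of_hilbertBasis (tensorBasis H K)

end Separability

section Measurability

variable {X : Type*} [MeasurableSpace X]
variable {H : Type*} [NormedAddCommGroup H] [InnerProductSpace ℂ H] [CompleteSpace H]

theorem measurable_of_hasSum {ι E : Type*} [Countable ι] [NormedAddCommGroup E]
    [MeasurableSpace E] [BorelSpace E] [SecondCountableTopology E] {f : ι → X → E} {g : X → E}
    (hf : ∀ i, Measurable (f i)) (h : ∀ x, HasSum (fun i => f i x) (g x)) : Measurable g := by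
  refine measurable_of_tendsto_metrizable' (f := fun (s : Finset ι) x => ∑ i ∈ s, f i x)
    Filter.atTop (fun s => Finset.measurable_fun_sum s fun i _ => hf i) ?_
  rw [tendsto_pi_nhds]
  intro x
  simpa only [HasSum, SummationFilter.unconditional_filter] using h x

theorem opNorm_le_iff_forall_denseSeq {E F : Type*} [NormedAddCommGroup E] [NormedSpace ℂ E]
    [TopologicalSpace.SeparableSpace E] [NormedAddCommGroup F] [NormedSpace ℂ F]
    (A : E →L[ℂ] F) {c : ℝ} (hc : 0 ≤ c) :
    ‖A‖ ≤ c ↔ ∀ n, ‖A (TopologicalSpace.denseSeq E n)‖ ≤ c * ‖TopologicalSpace.denseSeq E n‖ := by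
  refine ⟨fun h n => A.le_of_opNorm_le h _, fun h => A.opNorm_le_bound hc fun η => ?_⟩
  exact (TopologicalSpace.denseRange_denseSeq E).induction_on
    (p := fun η => ‖A η‖ ≤ c * ‖η‖) η (isClosed_le (by fun_prop) (by fun_prop)) h

theorem IsQRV.measurable_normalFunctional {f : X → (H →L[ℂ] H)} (hf : IsQRV f)
    {φ : (H →L[ℂ] H) → ℂ} (hφ : φ ∈ normalFunctional H) : Measurable fun x => φ (f x) := by
  induction hφ using Submodule.span_induction with
  | mem φ hφ =>
    obtain ⟨s, rfl⟩ := hφ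
    exact hf s
  | zero => exact measurable_const
  | add φ ψ _ _ hφ hψ => exact hφ.add hψ
  | smul c φ _ hφ => exact hφ.const_mul c

theorem IsQRV.measurable_inner {f : X → (H →L[ℂ] H)} (hf : IsQRV f) (ξ η : H) :
    Measurable fun x => ⟪ξ, f x η⟫_ℂ :=
  hf.measurable_normalFunctional (inner_map_mem_normalFunctional ξ η)

theorem IsQRV.add {f g : X → (H →L[ℂ] H)} (hf : IsQRV f) (hg : IsQRV g) :
    IsQRV (f + g) := fun s => by
  simp only [Pi.add_apply, s.trace_mul_add]
  exact (hf s).add (hg s)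

theorem IsQRV.fun_smul {f : X → (H →L[ℂ] H)} (hf : IsQRV f) {c : X → ℂ} (hc : Measurable c) :
    IsQRV fun x => c x • f x := fun s => by
  simp only [s.trace_mul_smul]
  exact hc.mul (hf s)

theorem IsQRV.const_smul {f : X → (H →L[ℂ] H)} (hf : IsQRV f) (c : ℂ) : IsQRV (c • f) :=
  hf.fun_smul measurable_const

theorem IsQRV.neg {f : X → (H →L[ℂ] H)} (hf : IsQRV f) : IsQRV (-f) := by
  simpa only [neg_one_smul] using hf.const_smul (-1)

theorem IsQRV.sub {f g : X → (H →L[ℂ] H)} (hf : IsQRV f) (hg : IsQRV g) : IsQRV (f - g) := by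
  rw [sub_eq_add_neg]
  exact hf.add hg.neg

theorem isQRV_const (A : H →L[ℂ] H) : IsQRV fun _ : X => A := fun _ => measurable_const

variable [TopologicalSpace.SeparableSpace H]

theorem isQRV_of_measurable_inner {f : X → (H →L[ℂ] H)}
    (h : ∀ ξ η : H, Measurable fun x => ⟪ξ, f x η⟫_ℂ) : IsQRV f :=
  fun s => measurable_of_hasSum (fun j => h (s.sqrtVectors j) (s.sqrtVectors j))
    fun x => s.hasSum_trace (f x)

theorem isQRV_of_hilbertBasis {ι : Type*} [Countable ι] (b : HilbertBasis ι ℂ H)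
    {f : X → (H →L[ℂ] H)} (h : ∀ i j, Measurable fun x => ⟪b i, f x (b j)⟫_ℂ) : IsQRV f := by
  have hright : ∀ (ξ : H) j, Measurable fun x => ⟪ξ, f x (b j)⟫_ℂ := fun ξ j =>
    measurable_of_hasSum (fun i => (h i j).const_mul ⟪ξ, b i⟫_ℂ)
      fun x => b.hasSum_inner_mul_inner ξ (f x (b j))
  refine isQRV_of_measurable_inner fun ξ η => ?_
  refine measurable_of_hasSum (fun j => (hright ξ j).mul_const ⟪b j, η⟫_ℂ) fun x => ?_
  simpa only [ContinuousLinearMap.adjoint_inner_left] using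
    b.hasSum_inner_mul_inner (ContinuousLinearMap.adjoint (f x) ξ) η

theorem IsQRV.fun_star {f : X → (H →L[ℂ] H)} (hf : IsQRV f) : IsQRV fun x => star (f x) := by
  refine isQRV_of_measurable_inner fun ξ η => ?_
  simpa only [Function.comp_def, inner_conj_symm, ContinuousLinearMap.star_eq_adjoint,
    ContinuousLinearMap.adjoint_inner_right] using
    Complex.continuous_conj.measurable.comp (hf.measurable_inner η ξ)

theorem IsQRV.measurable_norm_apply {f : X → (H →L[ℂ] H)} (hf : IsQRV f) (η : H) :
    Measurable fun x => ‖f x η‖ := by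
  have h : Measurable fun x => ‖f x η‖ ^ 2 :=
    measurable_of_hasSum (fun i => ((hf.measurable_inner (basis H i) η).norm.pow_const 2))
      fun x => hasSum_norm_inner_sq (f x η)
  simpa [Real.sqrt_sq] using h.sqrt

theorem IsQRV.measurable_norm {f : X → (H →L[ℂ] H)} (hf : IsQRV f) :
    Measurable fun x => ‖f x‖ := by
  refine measurable_of_Iic fun c => ?_
  change MeasurableSet {x | ‖f x‖ ≤ c}
  rcases lt_or_ge c 0 with hc | hc
  · simp only [(hc.trans_le (norm_nonneg _)).not_ge, Set.ofPred_false, MeasurableSet.empty]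
  · simp only [opNorm_le_iff_forall_denseSeq _ hc, Set.ofPred_forall]
    exact MeasurableSet.iInter fun n =>
      measurableSet_le (hf.measurable_norm_apply _) measurable_const

theorem IsQRV.funTensor {K : Type*} [NormedAddCommGroup K] [InnerProductSpace ℂ K]
    [CompleteSpace K] [TopologicalSpace.SeparableSpace K]
    {f : X → (H →L[ℂ] H)} {g : X → (K →L[ℂ] K)} (hf : IsQRV f) (hg : IsQRV g) :
    IsQRV (funTensor f g) := by
  refine isQRV_of_hilbertBasis (tensorBasis H K) fun p q => ?_
  simp only [tensorBasis_apply, QRV.funTensor, opTensor_tmul, HTensor.inner_tmul]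
  exact (hf.measurable_inner _ _).mul (hg.measurable_inner _ _)

theorem IsQRV.fun_norm_smul_one {f : X → (H →L[ℂ] H)} (hf : IsQRV f) :
    IsQRV fun x => (‖f x‖ : ℂ) • (1 : H →L[ℂ] H) :=
  (isQRV_const 1).fun_smul (Complex.measurable_ofReal.comp hf.measurable_norm)

end Measurability

section PositiveParts

open scoped ComplexStarModule

variable {H : Type*} [NormedAddCommGroup H] [InnerProductSpace ℂ H]

/-- The operator `(‖A‖ + A) / 2`. For self-adjoint `A` it is positive, and
`A = normShift A - normShift (-A)`: unlike the positive part of `A`, it depends on `A` in an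
obviously measurable way. -/
def normShift (A : H →L[ℂ] H) : H →L[ℂ] H :=
  (2⁻¹ : ℂ) • ((‖A‖ : ℂ) • 1 + A)

theorem normShift_sub_normShift_neg (A : H →L[ℂ] H) : normShift A - normShift (-A) = A := by
  simp only [normShift, norm_neg]
  module

theorem normShift_add_normShift_neg (A : H →L[ℂ] H) :
    normShift A + normShift (-A) = (‖A‖ : ℂ) • 1 := by
  simp only [normShift, norm_neg]
  module

theorem norm_norm_smul_one_le (A : H →L[ℂ] H) : ‖(‖A‖ : ℂ) • (1 : H →L[ℂ] H)‖ ≤ ‖A‖ := by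
  rw [norm_smul, Complex.norm_real, norm_norm]
  exact mul_le_of_le_one_right (norm_nonneg _) ContinuousLinearMap.norm_id_le

variable [CompleteSpace H]

theorem norm_smul_one_nonneg (A : H →L[ℂ] H) : 0 ≤ (‖A‖ : ℂ) • (1 : H →L[ℂ] H) := by
  rw [Complex.coe_smul]
  exact smul_nonneg (norm_nonneg A) zero_le_one

theorem normShift_nonneg {A : H →L[ℂ] H} (hA : IsSelfAdjoint A) : 0 ≤ normShift A := by
  have h := hA.neg_algebraMap_norm_le_self
  rw [Algebra.algebraMap_eq_smul_one, ← Complex.coe_smul, neg_le_iff_add_nonneg, add_comm] at h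
  exact smul_nonneg (by positivity) h

/-- Four positive functions representing `g`: the shifts by the norm of the real and imaginary
parts of `g` and of their negatives. -/
def shiftedParts {X : Type*} (g : X → (H →L[ℂ] H)) : Fin 4 → X → (H →L[ℂ] H) :=
  ![fun x => normShift (ℜ (g x)), fun x => normShift (-ℜ (g x)),
    fun x => normShift (ℑ (g x)), fun x => normShift (-ℑ (g x))]

theorem shiftedParts_nonneg {X : Type*} (g : X → (H →L[ℂ] H)) (k : Fin 4) (x : X) :
    0 ≤ shiftedParts g k x := by
  fin_cases k
  · exact normShift_nonneg (ℜ (g x)).2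
  · exact normShift_nonneg (ℜ (g x)).2.neg
  · exact normShift_nonneg (ℑ (g x)).2
  · exact normShift_nonneg (ℑ (g x)).2.neg

theorem eq_shiftedParts {X : Type*} (g : X → (H →L[ℂ] H)) :
    g = shiftedParts g 0 - shiftedParts g 1 + Complex.I • shiftedParts g 2 -
      Complex.I • shiftedParts g 3 := by
  funext x
  conv_lhs => rw [← realPart_add_I_smul_imaginaryPart (g x),
    ← normShift_sub_normShift_neg (ℜ (g x) : H →L[ℂ] H),
    ← normShift_sub_normShift_neg (ℑ (g x) : H →L[ℂ] H), smul_sub, ← add_sub_assoc]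
  rfl

theorem norm_sum_shiftedParts_le {X : Type*} (g : X → (H →L[ℂ] H)) (x : X) :
    ‖(shiftedParts g 0 + shiftedParts g 1 + shiftedParts g 2 + shiftedParts g 3) x‖ ≤
      2 * ‖g x‖ := by
  have hsum : (shiftedParts g 0 + shiftedParts g 1 + shiftedParts g 2 + shiftedParts g 3) x =
      (‖(ℜ (g x) : H →L[ℂ] H)‖ : ℂ) • 1 + (‖(ℑ (g x) : H →L[ℂ] H)‖ : ℂ) • 1 := by
    rw [← normShift_add_normShift_neg, ← normShift_add_normShift_neg, ← add_assoc]
    rfl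
  calc ‖(shiftedParts g 0 + shiftedParts g 1 + shiftedParts g 2 + shiftedParts g 3) x‖
      ≤ ‖(ℜ (g x) : H →L[ℂ] H)‖ + ‖(ℑ (g x) : H →L[ℂ] H)‖ := by
        rw [hsum]
        exact (norm_add_le _ _).trans
          (add_le_add (norm_norm_smul_one_le _) (norm_norm_smul_one_le _))
    _ ≤ ‖g x‖ + ‖g x‖ := add_le_add (realPart.norm_le (g x)) (imaginaryPart.norm_le (g x))
    _ = 2 * ‖g x‖ := (two_mul _).symm

variable {X : Type*} [MeasurableSpace X] [TopologicalSpace.SeparableSpace H]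

theorem IsQRV.fun_normShift {a : X → (H →L[ℂ] H)} (ha : IsQRV a) :
    IsQRV fun x => normShift (a x) :=
  (ha.fun_norm_smul_one.add ha).const_smul _

theorem IsQRV.fun_realPart {g : X → (H →L[ℂ] H)} (hg : IsQRV g) :
    IsQRV fun x => (ℜ (g x) : H →L[ℂ] H) := by
  simp only [realPart_apply_coe, ← Complex.coe_smul]
  exact (hg.add hg.fun_star).const_smul _

theorem IsQRV.fun_imaginaryPart {g : X → (H →L[ℂ] H)} (hg : IsQRV g) :
    IsQRV fun x => (ℑ (g x) : H →L[ℂ] H) := by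
  simpa only [realPart_I_smul, NegMemClass.coe_neg, Pi.smul_apply, neg_neg, Pi.neg_def] using
    (hg.const_smul Complex.I).fun_realPart.neg

theorem IsQRV.shiftedParts {g : X → (H →L[ℂ] H)} (hg : IsQRV g) (k : Fin 4) :
    IsQRV (shiftedParts g k) := by
  fin_cases k
  · exact hg.fun_realPart.fun_normShift
  · exact hg.fun_realPart.neg.fun_normShift
  · exact hg.fun_imaginaryPart.fun_normShift
  · exact hg.fun_imaginaryPart.neg.fun_normShift

theorem mem_qrvSpan_iff {f : X → (H →L[ℂ] H)} : f ∈ qrvSpan X H ↔ IsQRV f := by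
  constructor
  · intro h
    induction h using Submodule.span_induction with
    | mem f hf => exact hf.1
    | zero => exact isQRV_const 0
    | add f g _ _ hf hg => exact hf.add hg
    | smul c f _ hf => exact hf.const_smul c
  · intro h
    have hmem : ∀ k, QRV.shiftedParts f k ∈ qrvSpan X H := fun k =>
      Submodule.subset_span ⟨h.shiftedParts k, shiftedParts_nonneg f k⟩
    rw [eq_shiftedParts f]
    exact sub_mem (add_mem (sub_mem (hmem 0) (hmem 1)) (Submodule.smul_mem _ _ (hmem 2)))
      (Submodule.smul_mem _ _ (hmem 3))

theorem mem_Pos_iff {f : X → (H →L[ℂ] H)} {F : Fin 4 → X → (H →L[ℂ] H)} :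
    F ∈ Pos f ↔ (∀ k, IsQRV (F k)) ∧ (∀ k x, 0 ≤ F k x) ∧
      f = F 0 - F 1 + Complex.I • F 2 - Complex.I • F 3 := by
  simp only [Pos, Set.mem_ofPred_eq, mem_qrvSpan_iff, forall_and, and_assoc]

theorem IsQRV.shiftedParts_mem_Pos {g : X → (H →L[ℂ] H)} (hg : IsQRV g) :
    QRV.shiftedParts g ∈ Pos g :=
  mem_Pos_iff.2 ⟨hg.shiftedParts, shiftedParts_nonneg g, eq_shiftedParts g⟩

theorem IsQRV.single_mem_Pos {g : X → (H →L[ℂ] H)} (hg : IsQRV g) (hg0 : ∀ x, 0 ≤ g x) :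
    ![g, 0, 0, 0] ∈ Pos g := by
  refine mem_Pos_iff.2 ⟨fun k => ?_, fun k x => ?_, by simp⟩
  · fin_cases k
    exacts [hg, isQRV_const 0, isQRV_const 0, isQRV_const 0]
  · fin_cases k
    exacts [hg0 x, le_rfl, le_rfl, le_rfl]

end PositiveParts

section Densities

variable {X : Type*} [MeasurableSpace X] {μ : Measure X}

theorem ae_nonneg_of_forall_setIntegral_nonneg_complex {g : X → ℂ} (hg : Integrable g μ)
    (h : ∀ E, MeasurableSet E → 0 ≤ ∫ x in E, g x ∂μ) : ∀ᵐ x ∂μ, 0 ≤ g x := by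
  have hre : ∀ᵐ x ∂μ, 0 ≤ (g x).re :=
    ae_nonneg_of_forall_setIntegral_nonneg hg.re fun E hE _ =>
      (Complex.nonneg_iff.1 (h E hE)).1.trans_eq (integral_re hg.integrableOn).symm
  have him : ∀ᵐ x ∂μ, (g x).im = 0 :=
    Integrable.ae_eq_of_forall_setIntegral_eq _ _ hg.im (integrable_zero _ _ _) fun E hE _ => by
      rw [integral_zero]
      exact (integral_im hg.integrableOn).trans (Complex.nonneg_iff.1 (h E hE)).2.symm
  filter_upwards [hre, him] with x hx_re hx_im
  exact Complex.nonneg_iff.2 ⟨hx_re, hx_im.symm⟩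

theorem nonneg_iff_inner_map_self_nonneg {H : Type*} [NormedAddCommGroup H]
    [InnerProductSpace ℂ H] {A : H →L[ℂ] H} : 0 ≤ A ↔ ∀ ξ : H, 0 ≤ ⟪ξ, A ξ⟫_ℂ := by
  rw [ContinuousLinearMap.nonneg_iff_isPositive]
  refine ⟨fun h => h.inner_nonneg_right, fun h =>
    (ContinuousLinearMap.isPositive_iff_complex A).2 fun ξ => ?_⟩
  have hself : ⟪A ξ, ξ⟫_ℂ = ⟪ξ, A ξ⟫_ℂ := by
    rw [← inner_conj_symm, Complex.conj_eq_iff_im, ← (Complex.nonneg_iff.1 (h ξ)).2]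
  rw [hself]
  exact ⟨Complex.ext (by simp) (by simpa using (Complex.nonneg_iff.1 (h ξ)).2),
    (Complex.nonneg_iff.1 (h ξ)).1⟩

variable {H : Type*} [NormedAddCommGroup H] [InnerProductSpace ℂ H] {f : X → (H →L[ℂ] H)}

theorem ae_nonneg_of_forall_setIntegral_inner_nonneg [TopologicalSpace.SeparableSpace H]
    (hf : ∀ ξ, Integrable (fun x => ⟪ξ, f x ξ⟫_ℂ) μ)
    (h : ∀ ξ E, MeasurableSet E → 0 ≤ ∫ x in E, ⟪ξ, f x ξ⟫_ℂ ∂μ) : ∀ᵐ x ∂μ, 0 ≤ f x := by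
  have hdense : ∀ᵐ x ∂μ, ∀ n,
      0 ≤ ⟪TopologicalSpace.denseSeq H n, f x (TopologicalSpace.denseSeq H n)⟫_ℂ :=
    ae_all_iff.2 fun n => ae_nonneg_of_forall_setIntegral_nonneg_complex (hf _) (h _)
  filter_upwards [hdense] with x hx
  refine nonneg_iff_inner_map_self_nonneg.2 fun ξ => ?_
  exact (TopologicalSpace.denseRange_denseSeq H).induction_on
    (p := fun ξ => 0 ≤ ⟪ξ, f x ξ⟫_ℂ) ξ (isClosed_le (by fun_prop) (by fun_prop)) hx

variable [CompleteSpace H]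

theorem clm_ext_hilbertBasis {ι : Type*} (b : HilbertBasis ι ℂ H) {A B : H →L[ℂ] H}
    (h : ∀ i j, ⟪b i, A (b j)⟫_ℂ = ⟪b i, B (b j)⟫_ℂ) : A = B := by
  have hcol : ∀ j, A (b j) = B (b j) := fun j => hilbertBasis_ext b fun i => h i j
  refine ContinuousLinearMap.adjoint.injective (ContinuousLinearMap.ext fun ξ =>
    hilbertBasis_ext b fun j => ?_)
  rw [ContinuousLinearMap.adjoint_inner_right, ContinuousLinearMap.adjoint_inner_right, hcol]

theorem POVM.stateMeasure_apply (ν : POVM X H) (ρ : State H) {E : Set X} (hE : MeasurableSet E) :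
    ν.stateMeasure ρ E = ENNReal.ofReal (trace (ρ.op * ν.toFun E)).re := by
  rw [POVM.stateMeasure, Measure.ofMeasurable_apply _ hE]

instance POVM.isFiniteMeasure_stateMeasure (ν : POVM X H) (ρ : State H) :
    IsFiniteMeasure (ν.stateMeasure ρ) :=
  ⟨by rw [ν.stateMeasure_apply ρ MeasurableSet.univ]; exact ENNReal.ofReal_lt_top⟩

theorem HasRNDeriv.isRNDeriv_rnDeriv {ν : POVM X H} (h : HasRNDeriv ν μ) :
    IsRNDeriv ν μ (rnDeriv ν μ) := by
  rw [rnDeriv, dif_pos h]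
  exact h.choose_spec

theorem IsRNDeriv.ae_eq [TopologicalSpace.SeparableSpace H] {ν : POVM X H}
    {D D' : X → (H →L[ℂ] H)} (h : IsRNDeriv ν μ D) (h' : IsRNDeriv ν μ D') : D =ᵐ[μ] D' := by
  have hentry : ∀ᵐ x ∂μ, ∀ i j,
      ⟪basis H i, D x (basis H j)⟫_ℂ = ⟪basis H i, D' x (basis H j)⟫_ℂ :=
    ae_all_iff.2 fun i => ae_all_iff.2 fun j =>
      Integrable.ae_eq_of_forall_setIntegral_eq _ _ (h.2 i j).1 (h'.2 i j).1 fun E hE _ => by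
        rw [← (h.2 i j).2 E hE, ← (h'.2 i j).2 E hE]
  filter_upwards [hentry] with x hx
  exact clm_ext_hilbertBasis (basis H) hx

/-- `Q` is a density of `τ` with respect to `μ` when both are tested against density operators.
(`IsRNDeriv` tests matrix entries instead.) The predicate `IsTensorPOVM` is of this form. -/
def IsWeakDensity (τ : POVM X H) (μ : Measure X) (Q : X → (H →L[ℂ] H)) : Prop :=
  ∀ s : State H, Integrable (fun x => trace (s.op * Q x)) μ ∧
    ∀ E, MeasurableSet E → trace (s.op * τ.toFun E) = ∫ x in E, trace (s.op * Q x) ∂μ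

theorem IsWeakDensity.normalFunctional {τ : POVM X H} (h : IsWeakDensity τ μ f)
    {φ : (H →L[ℂ] H) → ℂ} (hφ : φ ∈ normalFunctional H) :
    Integrable (fun x => φ (f x)) μ ∧
      ∀ E, MeasurableSet E → φ (τ.toFun E) = ∫ x in E, φ (f x) ∂μ := by
  induction hφ using Submodule.span_induction with
  | mem φ hφ =>
    obtain ⟨s, rfl⟩ := hφ
    exact h s
  | zero => simp
  | add φ ψ _ _ hφ hψ =>
    refine ⟨hφ.1.add hψ.1, fun E hE => ?_⟩
    simp only [Pi.add_apply, hφ.2 E hE, hψ.2 E hE]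
    exact (integral_add hφ.1.integrableOn hψ.1.integrableOn).symm
  | smul c φ _ hφ =>
    refine ⟨hφ.1.const_mul c, fun E hE => ?_⟩
    simp only [Pi.smul_apply, hφ.2 E hE]
    exact (integral_smul c _).symm

/-- The scalar density of `E ↦ tr (σ τ(E))` when `τ` has the positive weak density `Q`. -/
def scalarDensity (σ : State H) (Q : X → (H →L[ℂ] H)) (x : X) : NNReal :=
  (trace (σ.op * Q x)).re.toNNReal

theorem IsQRV.measurable_scalarDensity (hf : IsQRV f) (σ : State H) :
    Measurable (scalarDensity σ f) :=
  (Complex.measurable_re.comp (hf σ)).real_toNNReal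

theorem State.FullRank.eq_zero_of_re_trace_mul_nonpos {σ : State H} (hσ : σ.FullRank)
    {A : H →L[ℂ] H} (hA : 0 ≤ A) (h : (trace (σ.op * A)).re ≤ 0) : A = 0 := by
  have htrace := Complex.nonneg_iff.1 (trace_mul_nonneg σ hA)
  exact hσ.eq_zero_of_trace_mul_eq_zero hA (Complex.ext (h.antisymm htrace.1) htrace.2.symm)

theorem IsWeakDensity.stateMeasure_eq {τ : POVM X H} (h : IsWeakDensity τ μ f)
    (h0 : ∀ᵐ x ∂μ, 0 ≤ f x) (σ : State H) :
    τ.stateMeasure σ = μ.withDensity fun x => (scalarDensity σ f x : ℝ≥0∞) := by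
  refine Measure.ext fun E hE => ?_
  have hint := (h σ).1.integrableOn (s := E)
  have hre : (∫ x in E, trace (σ.op * f x) ∂μ).re = ∫ x in E, (trace (σ.op * f x)).re ∂μ :=
    (integral_re hint).symm
  rw [τ.stateMeasure_apply σ hE, withDensity_apply _ hE, (h σ).2 E hE, hre]
  refine ofReal_integral_eq_lintegral_ofReal (f := fun x => (trace (σ.op * f x)).re) hint.re
    (ae_restrict_of_ae ?_)
  filter_upwards [h0] with x hx
  exact (Complex.nonneg_iff.1 (trace_mul_nonneg σ hx)).1

theorem IsWeakDensity.absolutelyContinuous {τ : POVM X H} (h : IsWeakDensity τ μ f)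
    (h0 : ∀ᵐ x ∂μ, 0 ≤ f x) (σ : State H) : τ.stateMeasure σ ≪ μ := by
  rw [h.stateMeasure_eq h0 σ]
  exact withDensity_absolutelyContinuous _ _

theorem IsWeakDensity.isRNDeriv {τ : POVM X H} (h : IsWeakDensity τ μ f) (hf : IsQRV f)
    (h0 : ∀ᵐ x ∂μ, 0 ≤ f x) {σ : State H} (hσ : σ.FullRank) :
    IsRNDeriv τ (τ.stateMeasure σ) fun x => ((scalarDensity σ f x : ℝ) : ℂ)⁻¹ • f x := by
  have hm := hf.measurable_scalarDensity σ
  have hentry : ∀ i j, (fun x => scalarDensity σ f x • ⟪basis H i,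
      (((scalarDensity σ f x : ℝ) : ℂ)⁻¹ • f x) (basis H j)⟫_ℂ) =ᵐ[μ]
        fun x => ⟪basis H i, f x (basis H j)⟫_ℂ := by
    intro i j
    filter_upwards [h0] with x hx
    by_cases hzero : scalarDensity σ f x = 0
    · simp [hσ.eq_zero_of_re_trace_mul_nonpos hx (Real.toNNReal_eq_zero.1 hzero)]
    · have hne : ((scalarDensity σ f x : ℝ) : ℂ) ≠ 0 := by exact_mod_cast hzero
      rw [smul_apply, inner_smul_right, NNReal.smul_def, Complex.real_smul,
        mul_inv_cancel_left₀ hne]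
  rw [h.stateMeasure_eq h0 σ]
  refine ⟨hf.fun_smul (Complex.measurable_ofReal.comp hm.coe_nnreal_real).inv,
    fun i j => ⟨?_, fun E hE => ?_⟩⟩
  · rw [integrable_withDensity_iff_integrable_smul hm]
    exact (h.normalFunctional (inner_map_mem_normalFunctional _ _)).1.congr (hentry i j).symm
  · rw [setIntegral_withDensity_eq_setIntegral_smul hm _ hE,
      (h.normalFunctional (inner_map_mem_normalFunctional _ _)).2 E hE]
    exact integral_congr_ae (ae_restrict_of_ae (hentry i j).symm)

end Densities

section BoundedDensities

variable {X : Type*} [MeasurableSpace X] {μ : Measure X} [IsFiniteMeasure μ]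
variable {H : Type*} [NormedAddCommGroup H] [InnerProductSpace ℂ H] [CompleteSpace H]
variable {f : X → (H →L[ℂ] H)} {C : ℝ}

theorem IsQRV.integrable_trace (hf : IsQRV f) (hC : ∀ᵐ x ∂μ, ‖f x‖ ≤ C) (s : State H) :
    Integrable (fun x => trace (s.op * f x)) μ := by
  refine Integrable.of_bound (hf s).aestronglyMeasurable C ?_
  filter_upwards [hC] with x hx
  exact (s.norm_trace_mul_le _).trans hx

variable [TopologicalSpace.SeparableSpace H]

theorem IsQRV.integrable_apply (hf : IsQRV f) (hC : ∀ᵐ x ∂μ, ‖f x‖ ≤ C) (η : H) :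
    Integrable (fun x => f x η) μ := by
  let _ : MeasurableSpace H := borel H
  have : BorelSpace H := ⟨rfl⟩
  have : SecondCountableTopology H := UniformSpace.secondCountable_of_separable H
  have hm : Measurable fun x => f x η := by
    refine measurable_of_hasSum
      (fun i => (hf.measurable_inner (basis H i) η).smul_const (basis H i)) fun x => ?_
    simpa only [HilbertBasis.repr_apply_apply] using (basis H).hasSum_repr (f x η)
  refine Integrable.of_bound hm.aestronglyMeasurable (C * ‖η‖) ?_
  filter_upwards [hC] with x hx
  exact (f x).le_of_opNorm_le hx η

theorem IsQRV.exists_inner_eq_integral (hf : IsQRV f) (hC : ∀ᵐ x ∂μ, ‖f x‖ ≤ C) :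
    ∃ A : H →L[ℂ] H, ∀ ξ η, ⟪ξ, A η⟫_ℂ = ∫ x, ⟪ξ, f x η⟫_ℂ ∂μ := by
  let A : H →ₗ[ℂ] H :=
    { toFun := fun η => ∫ x, f x η ∂μ
      map_add' := fun η η' => by
        simp only [map_add]
        exact integral_add (hf.integrable_apply hC η) (hf.integrable_apply hC η')
      map_smul' := fun c η => by
        simp only [map_smul, RingHom.id_apply]
        exact integral_smul c _ }
  have hA : ∀ η, ‖A η‖ ≤ (C * μ.real Set.univ) * ‖η‖ := fun η =>
    calc ‖A η‖ ≤ (C * ‖η‖) * μ.real Set.univ := norm_integral_le_of_norm_le_const <| by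
          filter_upwards [hC] with x hx
          exact (f x).le_of_opNorm_le hx η
      _ = (C * μ.real Set.univ) * ‖η‖ := by ring
  exact ⟨A.mkContinuous _ hA, fun ξ η => (integral_inner (hf.integrable_apply hC η) ξ).symm⟩

theorem IsQRV.trace_mul_eq_integral (hf : IsQRV f) (hC : ∀ᵐ x ∂μ, ‖f x‖ ≤ C) {A : H →L[ℂ] H}
    (hA : ∀ ξ η, ⟪ξ, A η⟫_ℂ = ∫ x, ⟪ξ, f x η⟫_ℂ ∂μ) (s : State H) :
    trace (s.op * A) = ∫ x, trace (s.op * f x) ∂μ := by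
  have hsum := s.hasSum_trace A
  simp only [hA] at hsum
  refine hsum.unique (hasSum_integral_of_dominated_convergence
    (fun j _ => C * ‖s.sqrtVectors j‖ ^ 2)
    (fun j => (hf.measurable_inner _ _).aestronglyMeasurable) (fun j => ?_)
    (.of_forall fun _ => s.hasSum_norm_sq_sqrtVectors.summable.mul_left C) (integrable_const _)
    (.of_forall fun x => s.hasSum_trace (f x)))
  filter_upwards [hC] with x hx
  calc ‖⟪s.sqrtVectors j, f x (s.sqrtVectors j)⟫_ℂ‖
      ≤ ‖s.sqrtVectors j‖ * ‖f x (s.sqrtVectors j)‖ := norm_inner_le_norm _ _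
    _ ≤ ‖s.sqrtVectors j‖ * (C * ‖s.sqrtVectors j‖) := by
        gcongr
        exact (f x).le_of_opNorm_le hx _
    _ = C * ‖s.sqrtVectors j‖ ^ 2 := by ring

theorem IsQRV.exists_povm_isWeakDensity (hf : IsQRV f) (hC : ∀ᵐ x ∂μ, ‖f x‖ ≤ C)
    (h0 : ∀ᵐ x ∂μ, 0 ≤ f x) : ∃ τ : POVM X H, IsWeakDensity τ μ f := by
  classical
  choose A hA using fun E : Set X =>
    hf.exists_inner_eq_integral (ae_restrict_of_ae (s := E) hC)
  have hA_trace : ∀ E (s : State H), trace (s.op * A E) = ∫ x in E, trace (s.op * f x) ∂μ :=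
    fun E => hf.trace_mul_eq_integral (ae_restrict_of_ae hC) (hA E)
  refine ⟨{
    toFun := fun E => if MeasurableSet E then A E else 0
    not_measurable := fun E hE => if_neg hE
    nonneg := fun E hE => ?_
    hasSum_iUnion := fun E hE hd s => ?_ },
    fun s => ⟨hf.integrable_trace hC s, fun E hE => by simp only [if_pos hE, hA_trace]⟩⟩
  · rw [if_pos hE, nonneg_iff_inner_map_self_nonneg]
    intro ξ
    rw [hA]
    refine integral_nonneg_of_ae (ae_restrict_of_ae ?_)
    filter_upwards [h0] with x hx
    exact nonneg_iff_inner_map_self_nonneg.1 hx ξ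
  · simp only [if_pos (hE _), if_pos (MeasurableSet.iUnion hE), hA_trace]
    exact hasSum_integral_iUnion hE hd (hf.integrable_trace hC s).integrableOn

theorem IsRNDeriv.inner_map_eq_setIntegral {ν : POVM X H} (h : IsRNDeriv ν μ f)
    (hC : ∀ᵐ x ∂μ, ‖f x‖ ≤ C) {E : Set X} (hE : MeasurableSet E) (ξ η : H) :
    ⟪ξ, ν.toFun E η⟫_ℂ = ∫ x in E, ⟪ξ, f x η⟫_ℂ ∂μ := by
  obtain ⟨A, hA⟩ := h.1.exists_inner_eq_integral (ae_restrict_of_ae (s := E) hC)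
  have hνA : ν.toFun E = A := clm_ext_hilbertBasis (basis H) fun i j => by
    rw [hA, (h.2 i j).2 E hE]
  rw [hνA, hA]

theorem IsRNDeriv.ae_nonneg {ν : POVM X H} (h : IsRNDeriv ν μ f) (hC : ∀ᵐ x ∂μ, ‖f x‖ ≤ C) :
    ∀ᵐ x ∂μ, 0 ≤ f x := by
  refine ae_nonneg_of_forall_setIntegral_inner_nonneg
    (fun ξ => (h.1.integrable_apply hC ξ).const_inner ξ) fun ξ E hE => ?_
  rw [← h.inner_map_eq_setIntegral hC hE]
  exact nonneg_iff_inner_map_self_nonneg.1 (ν.nonneg E hE) ξ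

end BoundedDensities

section Slices

variable {X : Type*} [MeasurableSpace X] {μ : Measure X}
variable {H : Type*} [NormedAddCommGroup H] [InnerProductSpace ℂ H] [CompleteSpace H]
variable {K : Type*} [NormedAddCommGroup K] [InnerProductSpace ℂ K] [CompleteSpace K]

theorem sqrt_ofReal_smul {A : H →L[ℂ] H} (hA : 0 ≤ A) {r : ℝ} (hr : 0 ≤ r) :
    CFC.sqrt ((r : ℂ) • A) = (√r : ℂ) • CFC.sqrt A := by
  refine CFC.sqrt_unique ?_ ?_
  · rw [smul_mul_smul_comm, CFC.sqrt_mul_sqrt_self A hA, ← Complex.ofReal_mul,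
      Real.mul_self_sqrt hr]
  · rw [Complex.coe_smul]
    exact smul_nonneg (Real.sqrt_nonneg r) (CFC.sqrt_nonneg A)

theorem norm_sqrt_mul_mul_sqrt_le {A : H →L[ℂ] H} (hA : 0 ≤ A) (B : H →L[ℂ] H) :
    ‖CFC.sqrt A * B * CFC.sqrt A‖ ≤ ‖B‖ * ‖A‖ :=
  calc ‖CFC.sqrt A * B * CFC.sqrt A‖
      ≤ ‖CFC.sqrt A‖ * ‖B‖ * ‖CFC.sqrt A‖ := norm_mul₃_le
    _ = ‖B‖ * (√‖A‖ * √‖A‖) := by rw [CFC.norm_sqrt A hA]; ring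
    _ = ‖B‖ * ‖A‖ := by rw [Real.mul_self_sqrt (norm_nonneg A)]

theorem slice_eq_of_rnDeriv_eq_smul {τ : POVM X H} {σ : State H} (s : State H)
    (F : X → (H →L[ℂ] H)) {x : X} {A : H →L[ℂ] H} (hA : 0 ≤ A) {r : ℝ} (hr : 0 ≤ r)
    (hx : rnDeriv τ (τ.stateMeasure σ) x = (r : ℂ) • A) :
    slice τ σ s F x = r * trace (s.op * (CFC.sqrt A * F x * CFC.sqrt A)) := by
  rw [slice, hx, sqrt_ofReal_smul hA hr, smul_mul_assoc, smul_mul_smul_comm,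
    ← Complex.ofReal_mul, Real.mul_self_sqrt hr, s.trace_mul_smul]

theorem IsWeakDensity.eLpNorm_slice [TopologicalSpace.SeparableSpace H] {τ : POVM X H}
    {Q : X → (H →L[ℂ] H)} (h : IsWeakDensity τ μ Q) (hQ : IsQRV Q) (h0 : ∀ᵐ x ∂μ, 0 ≤ Q x)
    {σ : State H} (hσ : σ.FullRank) (s : State H) (F : X → (H →L[ℂ] H)) :
    eLpNorm (slice τ σ s F) 1 (τ.stateMeasure σ) =
      ∫⁻ x, ‖trace (s.op * (CFC.sqrt (Q x) * F x * CFC.sqrt (Q x)))‖ₑ ∂μ := by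
  have hrn := h.isRNDeriv hQ h0 hσ
  have hslice : ∀ᵐ x ∂(τ.stateMeasure σ), ‖slice τ σ s F x‖ₑ =
      ‖((scalarDensity σ Q x : ℝ)⁻¹ : ℂ) *
        trace (s.op * (CFC.sqrt (Q x) * F x * CFC.sqrt (Q x)))‖ₑ := by
    filter_upwards [(HasRNDeriv.isRNDeriv_rnDeriv ⟨_, hrn⟩).ae_eq hrn,
      h.absolutelyContinuous h0 σ h0] with x hx hQx
    rw [slice_eq_of_rnDeriv_eq_smul s F hQx (inv_nonneg.2 (scalarDensity σ Q x).2)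
      (by rw [hx, Complex.ofReal_inv]; rfl), Complex.ofReal_inv]
    rfl
  rw [eLpNorm_one_eq_lintegral_enorm, lintegral_congr_ae hslice, h.stateMeasure_eq h0 σ,
    lintegral_withDensity_eq_lintegral_mul_non_measurable _
      (hQ.measurable_scalarDensity σ).coe_nnreal_ennreal (.of_forall fun x => ENNReal.coe_lt_top)]
  refine lintegral_congr_ae ?_
  filter_upwards [h0] with x hx
  by_cases hzero : scalarDensity σ Q x = 0
  · rw [hσ.eq_zero_of_re_trace_mul_nonpos hx (Real.toNNReal_eq_zero.1 hzero)]
    simp [trace, hzero]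
  · have hcancel : ((scalarDensity σ Q x : NNReal) : ℝ≥0∞) *
        ‖((scalarDensity σ Q x : ℝ)⁻¹ : ℂ)‖ₑ = 1 := by
      rw [← ofReal_norm, norm_inv, Complex.norm_real, NNReal.norm_eq, ← NNReal.coe_inv,
        ENNReal.ofReal_coe_nnreal, ← ENNReal.coe_mul, mul_inv_cancel₀ hzero, ENNReal.coe_one]
    rw [Pi.mul_apply, enorm_mul, ← mul_assoc, hcancel, one_mul]

theorem IsWeakDensity.eLpNorm_slice_of_mul_self_eq [TopologicalSpace.SeparableSpace H]
    {τ : POVM X H} {Q R : X → (H →L[ℂ] H)} (h : IsWeakDensity τ μ Q) (hQ : IsQRV Q)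
    (hR : ∀ x, 0 ≤ R x) (hRR : ∀ᵐ x ∂μ, R x * R x = Q x) {σ : State H} (hσ : σ.FullRank)
    (s : State H) (F : X → (H →L[ℂ] H)) :
    eLpNorm (slice τ σ s F) 1 (τ.stateMeasure σ) =
      ∫⁻ x, ‖trace (s.op * (R x * F x * R x))‖ₑ ∂μ := by
  have h0 : ∀ᵐ x ∂μ, 0 ≤ Q x := by
    filter_upwards [hRR] with x hx
    rw [← hx]
    exact (hR x).isSelfAdjoint.mul_self_nonneg
  rw [h.eLpNorm_slice hQ h0 hσ]
  refine lintegral_congr_ae ?_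
  filter_upwards [hRR] with x hx
  rw [CFC.sqrt_unique hx (hR x)]

theorem State.norm_trace_opTensor_sqrt_le (s : State (HTensor H K)) {D F : H →L[ℂ] H}
    {D' G : K →L[ℂ] K} (hD' : 0 ≤ D') (hF : 0 ≤ F) (hG : 0 ≤ G) :
    ‖trace (s.op * (opTensor (CFC.sqrt D) (CFC.sqrt D') * opTensor F G *
        opTensor (CFC.sqrt D) (CFC.sqrt D')))‖ ≤
      ‖G‖ * ‖D'‖ * ‖trace (s.partialTrace.op * (CFC.sqrt D * F * CFC.sqrt D))‖ := by
  rw [← opTensor_mul, ← opTensor_mul]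
  refine (s.norm_trace_opTensor_le (conjugate_nonneg_of_nonneg hF (CFC.sqrt_nonneg D))
    (conjugate_nonneg_of_nonneg hG (CFC.sqrt_nonneg D'))).trans ?_
  gcongr
  exact norm_sqrt_mul_mul_sqrt_le hD' G

/-- A quantum random variable that is positive almost everywhere. -/
structure IsPositiveQRV (μ : Measure X) (D : X → (H →L[ℂ] H)) : Prop where
  isQRV : IsQRV D
  ae_nonneg : ∀ᵐ x ∂μ, 0 ≤ D x

variable [TopologicalSpace.SeparableSpace H] [TopologicalSpace.SeparableSpace K]

theorem IsPositiveQRV.funTensor {D : X → (H →L[ℂ] H)} {D' : X → (K →L[ℂ] K)}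
    (hD : IsPositiveQRV μ D) (hD' : IsPositiveQRV μ D') :
    IsPositiveQRV μ (funTensor D D') := by
  refine ⟨hD.isQRV.funTensor hD'.isQRV, ?_⟩
  filter_upwards [hD.ae_nonneg, hD'.ae_nonneg] with x hx hx'
  exact opTensor_nonneg hx hx'

theorem IsWeakDensity.eLpNorm_slice_funTensor_le {τ : POVM X (HTensor H K)}
    {D : X → (H →L[ℂ] H)} {D' : X → (K →L[ℂ] K)} (h : IsWeakDensity τ μ (funTensor D D'))
    (hD : IsPositiveQRV μ D) (hD' : IsPositiveQRV μ D') (hD'_fin : eLpNormEssSup D' μ < ∞)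
    {σ : State (HTensor H K)} (hσ : σ.FullRank) (s : State (HTensor H K))
    {F : X → (H →L[ℂ] H)} (hF : ∀ x, 0 ≤ F x) {G : X → (K →L[ℂ] K)} (hG : ∀ x, 0 ≤ G x)
    (hG_fin : eLpNormEssSup G μ < ∞) :
    eLpNorm (slice τ σ s (QRV.funTensor F G)) 1 (τ.stateMeasure σ) ≤
      eLpNormEssSup G μ * eLpNormEssSup D' μ *
        ∫⁻ x, ‖trace (s.partialTrace.op * (CFC.sqrt (D x) * F x * CFC.sqrt (D x)))‖ₑ ∂μ := by
  have hsqrt : ∀ᵐ x ∂μ, opTensor (CFC.sqrt (D x)) (CFC.sqrt (D' x)) *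
      opTensor (CFC.sqrt (D x)) (CFC.sqrt (D' x)) = funTensor D D' x := by
    filter_upwards [hD.ae_nonneg, hD'.ae_nonneg] with x hx hx'
    rw [← opTensor_mul, CFC.sqrt_mul_sqrt_self (D x) hx, CFC.sqrt_mul_sqrt_self (D' x) hx',
      funTensor]
  rw [h.eLpNorm_slice_of_mul_self_eq (hD.isQRV.funTensor hD'.isQRV)
      (fun x => opTensor_nonneg (CFC.sqrt_nonneg (D x)) (CFC.sqrt_nonneg (D' x))) hsqrt hσ,
    ← lintegral_const_mul' _ _ (ENNReal.mul_lt_top hG_fin hD'_fin).ne]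
  refine lintegral_mono_ae ?_
  filter_upwards [hD'.ae_nonneg, ae_le_eLpNormEssSup (f := G),
    ae_le_eLpNormEssSup (f := D')] with x hx' hGx hDx'
  have hpoint :=
    ENNReal.ofReal_le_ofReal (s.norm_trace_opTensor_sqrt_le (D := D x) hx' (hF x) (hG x))
  rw [ENNReal.ofReal_mul (by positivity), ENNReal.ofReal_mul (norm_nonneg _), ofReal_norm,
    ofReal_norm, ofReal_norm, ofReal_norm] at hpoint
  exact hpoint.trans (by gcongr)

end Slices

section Seminorms

theorem le_const_mul_biInf {ι : Type*} {P : Set ι} (hP : P.Nonempty) {v : ι → ℝ≥0∞}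
    {a C : ℝ≥0∞} (hC : C ≠ ∞) (h : ∀ i ∈ P, a ≤ C * v i) : a ≤ C * ⨅ i ∈ P, v i := by
  rcases eq_or_ne C 0 with rfl | h0
  · obtain ⟨i, hi⟩ := hP
    simpa using h i hi
  · simp only [ENNReal.mul_iInf_of_ne h0 hC]
    exact le_iInf₂ h

variable {X : Type*}
variable {H : Type*} [NormedAddCommGroup H] [InnerProductSpace ℂ H]
variable {K : Type*} [NormedAddCommGroup K] [InnerProductSpace ℂ K]

/-- The products `F_k ⊗ G_l`, collected according to the power of `i` they carry in the product of
`F_0 - F_1 + i F_2 - i F_3` and `G_0 - G_1 + i G_2 - i G_3`. -/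
def tensorParts (F : Fin 4 → X → (H →L[ℂ] H)) (G : Fin 4 → X → (K →L[ℂ] K)) :
    Fin 4 → X → (HTensor H K →L[ℂ] HTensor H K) :=
  ![funTensor (F 0) (G 0) + funTensor (F 1) (G 1) + funTensor (F 2) (G 3) + funTensor (F 3) (G 2),
    funTensor (F 0) (G 1) + funTensor (F 1) (G 0) + funTensor (F 2) (G 2) + funTensor (F 3) (G 3),
    funTensor (F 0) (G 2) + funTensor (F 1) (G 3) + funTensor (F 2) (G 0) + funTensor (F 3) (G 1),
    funTensor (F 0) (G 3) + funTensor (F 1) (G 2) + funTensor (F 2) (G 1) + funTensor (F 3) (G 0)]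

theorem sum_tensorParts (F : Fin 4 → X → (H →L[ℂ] H)) (G : Fin 4 → X → (K →L[ℂ] K)) :
    tensorParts F G 0 + tensorParts F G 1 + tensorParts F G 2 + tensorParts F G 3 =
      funTensor (F 0 + F 1 + F 2 + F 3) (G 0 + G 1 + G 2 + G 3) := by
  funext x
  simp only [tensorParts, Matrix.cons_val, funTensor, Pi.add_apply, opTensor_add_left,
    opTensor_add_right]
  abel

variable [MeasurableSpace X] [CompleteSpace H] [CompleteSpace K]

theorem Pos.add {f g : X → (H →L[ℂ] H)} {F G : Fin 4 → X → (H →L[ℂ] H)} (hF : F ∈ Pos f)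
    (hG : G ∈ Pos g) : F + G ∈ Pos (f + g) := by
  refine ⟨fun k => ⟨add_mem (hF.1 k).1 (hG.1 k).1,
    fun x => add_nonneg ((hF.1 k).2 x) ((hG.1 k).2 x)⟩, ?_⟩
  rw [hF.2, hG.2]
  simp only [Pi.add_apply]
  module

theorem Pos.sum_nonneg {f : X → (H →L[ℂ] H)} {F : Fin 4 → X → (H →L[ℂ] H)} (hF : F ∈ Pos f)
    (x : X) : 0 ≤ (F 0 + F 1 + F 2 + F 3) x :=
  have h := fun k => (hF.1 k).2 x
  add_nonneg (add_nonneg (add_nonneg (h 0) (h 1)) (h 2)) (h 3)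

variable [TopologicalSpace.SeparableSpace H] [TopologicalSpace.SeparableSpace K]

theorem pNorm_le_of_ae_eq (ν : POVM X H) (ρ : State H) (p : ℝ≥0∞) {f f' : X → (H →L[ℂ] H)}
    (hf : IsQRV f) (hf' : IsQRV f') (h : f =ᵐ[ν.stateMeasure ρ] f') :
    pNorm ν ρ p f ≤ pNorm ν ρ p f' := by
  refine le_iInf₂ fun F hF => ?_
  have hmem := Pos.add hF (hf.sub hf').shiftedParts_mem_Pos
  rw [add_sub_cancel] at hmem
  refine (iInf₂_le _ hmem).trans (iSup_mono fun s => (eLpNorm_congr_ae ?_).le)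
  filter_upwards [h] with x hx
  have hzero : (shiftedParts (f - f') 0 + shiftedParts (f - f') 1 + shiftedParts (f - f') 2 +
      shiftedParts (f - f') 3) x = 0 := by
    simpa [hx] using norm_sum_shiftedParts_le (f - f') x
  have hsum : ((F + shiftedParts (f - f')) 0 + (F + shiftedParts (f - f')) 1 +
      (F + shiftedParts (f - f')) 2 + (F + shiftedParts (f - f')) 3) x =
      (F 0 + F 1 + F 2 + F 3) x := by
    rw [← add_zero ((F 0 + F 1 + F 2 + F 3) x), ← hzero]
    simp only [Pi.add_apply]
    abel
  rw [slice, slice, hsum]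

theorem tensorParts_mem_Pos {f : X → (H →L[ℂ] H)} {g : X → (K →L[ℂ] K)}
    {F : Fin 4 → X → (H →L[ℂ] H)} (hF : F ∈ Pos f) {G : Fin 4 → X → (K →L[ℂ] K)}
    (hG : G ∈ Pos g) : tensorParts F G ∈ Pos (funTensor f g) := by
  obtain ⟨hF_qrv, hF0, hf⟩ := mem_Pos_iff.1 hF
  obtain ⟨hG_qrv, hG0, hg⟩ := mem_Pos_iff.1 hG
  have hqrv : ∀ k l, IsQRV (funTensor (F k) (G l)) := fun k l => (hF_qrv k).funTensor (hG_qrv l)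
  have hnonneg : ∀ k l x, 0 ≤ funTensor (F k) (G l) x := fun k l x =>
    opTensor_nonneg (hF0 k x) (hG0 l x)
  refine mem_Pos_iff.2 ⟨fun k => ?_, fun k x => ?_, ?_⟩
  · fin_cases k <;> exact (((hqrv _ _).add (hqrv _ _)).add (hqrv _ _)).add (hqrv _ _)
  · fin_cases k <;> exact add_nonneg (add_nonneg (add_nonneg (hnonneg _ _ x) (hnonneg _ _ x))
      (hnonneg _ _ x)) (hnonneg _ _ x)
  · funext x
    rw [hf, hg]
    simp only [tensorParts, Matrix.cons_val, funTensor, Pi.add_apply, Pi.sub_apply, Pi.smul_apply,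
      opTensor_add_left, opTensor_add_right, opTensor_sub_left, opTensor_sub_right,
      opTensor_smul_left, opTensor_smul_right]
    match_scalars <;> simp

section Product

variable {ν : POVM X H} {ρ : State H} {τ : POVM X (HTensor H K)} {D' : X → (K →L[ℂ] K)}
  (h : IsWeakDensity τ (ν.stateMeasure ρ) (funTensor (rnDeriv ν (ν.stateMeasure ρ)) D'))
  (hD : IsPositiveQRV (ν.stateMeasure ρ) (rnDeriv ν (ν.stateMeasure ρ)))
  (hD' : IsPositiveQRV (ν.stateMeasure ρ) D') (hD'_fin : eLpNormEssSup D' (ν.stateMeasure ρ) < ∞)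
  {σ : State (HTensor H K)} (hσ : σ.FullRank)
include h hD hD' hD'_fin hσ

theorem IsWeakDensity.pNorm_funTensor_le_of_mem_Pos {f : X → (H →L[ℂ] H)} (hf : IsQRV f)
    {g : X → (K →L[ℂ] K)} {G : Fin 4 → X → (K →L[ℂ] K)} (hG : G ∈ Pos g)
    (hG_fin : eLpNormEssSup (G 0 + G 1 + G 2 + G 3) (ν.stateMeasure ρ) < ∞) :
    pNorm τ σ 1 (QRV.funTensor f g) ≤
      eLpNormEssSup (G 0 + G 1 + G 2 + G 3) (ν.stateMeasure ρ) *
        eLpNormEssSup D' (ν.stateMeasure ρ) * pNorm ν ρ 1 f := by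
  refine le_const_mul_biInf ⟨_, hf.shiftedParts_mem_Pos⟩ (ENNReal.mul_lt_top hG_fin hD'_fin).ne
    fun F hF => (iInf₂_le _ (tensorParts_mem_Pos hF hG)).trans (iSup_le fun s => ?_)
  rw [sum_tensorParts]
  refine (h.eLpNorm_slice_funTensor_le hD hD' hD'_fin hσ s (Pos.sum_nonneg hF) (Pos.sum_nonneg hG)
    hG_fin).trans ?_
  gcongr
  refine le_iSup_of_le s.partialTrace ?_
  rw [eLpNorm_one_eq_lintegral_enorm]
  rfl

theorem IsWeakDensity.pNorm_funTensor_le {f : X → (H →L[ℂ] H)} (hf : IsQRV f)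
    {g : X → (K →L[ℂ] K)} (hg : IsQRV g) (hg_fin : eLpNormEssSup g (ν.stateMeasure ρ) < ∞) :
    pNorm τ σ 1 (QRV.funTensor f g) ≤
      2 * eLpNormEssSup D' (ν.stateMeasure ρ) * pNorm ν ρ 1 f *
        eLpNormEssSup g (ν.stateMeasure ρ) := by
  have hsum : eLpNormEssSup (shiftedParts g 0 + shiftedParts g 1 + shiftedParts g 2 +
      shiftedParts g 3) (ν.stateMeasure ρ) ≤ 2 * eLpNormEssSup g (ν.stateMeasure ρ) := by
    refine eLpNormEssSup_le_nnreal_smul_eLpNormEssSup_of_ae_le_mul (c := 2) (.of_forall fun x => ?_)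
    exact_mod_cast norm_sum_shiftedParts_le g x
  refine (h.pNorm_funTensor_le_of_mem_Pos hD hD' hD'_fin hσ hf hg.shiftedParts_mem_Pos
    (hsum.trans_lt (ENNReal.mul_lt_top ENNReal.ofNat_lt_top hg_fin))).trans ?_
  calc _ ≤ 2 * eLpNormEssSup g (ν.stateMeasure ρ) * eLpNormEssSup D' (ν.stateMeasure ρ) *
        pNorm ν ρ 1 f := by gcongr
    _ = _ := by ring

theorem IsWeakDensity.pNorm_funTensor_le_of_nonneg {f : X → (H →L[ℂ] H)} (hf : IsQRV f)
    {g : X → (K →L[ℂ] K)} (hg : IsQRV g) (hg0 : ∀ x, 0 ≤ g x)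
    (hg_fin : eLpNormEssSup g (ν.stateMeasure ρ) < ∞) :
    pNorm τ σ 1 (QRV.funTensor f g) ≤
      eLpNormEssSup g (ν.stateMeasure ρ) * eLpNormEssSup D' (ν.stateMeasure ρ) *
        pNorm ν ρ 1 f := by
  simpa using h.pNorm_funTensor_le_of_mem_Pos hD hD' hD'_fin hσ hf (hg.single_mem_Pos hg0)
    (by simpa using hg_fin)

end Product

end Seminorms

section Blocks

variable {H : Type*} [NormedAddCommGroup H] [InnerProductSpace ℂ H] [CompleteSpace H]
variable {K : Type*} [NormedAddCommGroup K] [InnerProductSpace ℂ K] [CompleteSpace K]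

theorem star_mul_self_le_norm_sq_smul_one (A : H →L[ℂ] H) :
    star A * A ≤ ((‖A‖ ^ 2 : ℝ) : ℂ) • 1 := by
  rw [Complex.coe_smul, ← Algebra.algebraMap_eq_smul_one]
  exact CStarAlgebra.star_mul_le_algebraMap_norm_sq

theorem blockNonneg_zero : BlockNonneg (0 : H →L[ℂ] H) 0 0 := fun ξ η => by simp

theorem blockNonneg_one : BlockNonneg (1 : H →L[ℂ] H) 1 1 := fun ξ η => by
  have h : 0 ≤ ⟪ξ + η, ξ + η⟫_ℂ := nonneg_iff_inner_map_self_nonneg.1 zero_le_one (ξ + η)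
  rw [inner_add_left, inner_add_right, inner_add_right, ← add_assoc] at h
  simpa [← ContinuousLinearMap.star_eq_adjoint] using h

theorem BlockNonneg.mul_right {A B C : H →L[ℂ] H} (h : BlockNonneg A B C) {U : H →L[ℂ] H} {c : ℝ}
    (hc : 0 < c) (hU : star U * C * U ≤ ((c ^ 2 : ℝ) : ℂ) • C) :
    BlockNonneg ((c : ℂ) • A) (B * U) ((c : ℂ) • C) := by
  -- The form `(A, B, C)` at `(c ξ, U η)` is at most `c` times the form on the right at `(ξ, η)`.
  intro ξ η
  have hcC : (c : ℂ) ≠ 0 := by exact_mod_cast hc.ne'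
  have hinv : (0 : ℂ) ≤ (c : ℂ)⁻¹ := by
    rw [← Complex.ofReal_inv]
    exact_mod_cast (inv_pos.2 hc).le
  have hC : ⟪U η, C (U η)⟫_ℂ ≤ (c : ℂ) ^ 2 * ⟪η, C η⟫_ℂ := by
    have h := nonneg_iff_inner_map_self_nonneg.1 (sub_nonneg.2 hU) η
    rw [sub_apply, inner_sub_right, sub_nonneg, mul_apply_eq_comp, mul_apply_eq_comp,
      ContinuousLinearMap.star_eq_adjoint, ContinuousLinearMap.adjoint_inner_right,
      smul_apply, inner_smul_right] at h
    exact_mod_cast h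
  have hadj : ⟪η, ContinuousLinearMap.adjoint (B * U) ξ⟫_ℂ =
      ⟪U η, ContinuousLinearMap.adjoint B ξ⟫_ℂ := by
    simp only [ContinuousLinearMap.adjoint_inner_right, mul_apply_eq_comp]
  have hscaled := (h ((c : ℂ) • ξ) (U η)).trans (add_le_add_right hC _)
  simp only [map_smul, inner_smul_left, inner_smul_right, Complex.conj_ofReal] at hscaled
  rw [hadj]
  simp only [smul_apply, mul_apply_eq_comp, inner_smul_right]
  convert mul_nonneg hinv hscaled using 1
  field_simp

theorem blockNonneg_norm_smul_one (f : H →L[ℂ] H) :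
    BlockNonneg ((‖f‖ : ℂ) • 1) f ((‖f‖ : ℂ) • 1) := by
  rcases eq_or_ne f 0 with rfl | hf
  · simpa using blockNonneg_zero
  · have h := blockNonneg_one.mul_right (U := f) (norm_pos_iff.2 hf)
      (by rw [mul_one]; exact star_mul_self_le_norm_sq_smul_one f)
    rwa [one_mul] at h

theorem BlockNonneg.opTensor_one {A B C : H →L[ℂ] H} (h : BlockNonneg A B C) :
    BlockNonneg (opTensor A (1 : K →L[ℂ] K)) (opTensor B 1) (opTensor C 1) := by
  intro w z
  have hadj : ContinuousLinearMap.adjoint (opTensor B (1 : K →L[ℂ] K)) =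
      opTensor (ContinuousLinearMap.adjoint B) 1 := by
    rw [adjoint_opTensor, ← ContinuousLinearMap.star_eq_adjoint (1 : K →L[ℂ] K), star_one]
  rw [hadj]
  exact (((hasSum_inner_map_contractRight A w w).add (hasSum_inner_map_contractRight B w z)).add
    (hasSum_inner_map_contractRight _ z w)).add (hasSum_inner_map_contractRight C z z) |>.nonneg
      fun j => h _ _

theorem BlockNonneg.opTensor {A B C : H →L[ℂ] H} (h : BlockNonneg A B C) (hC : 0 ≤ C)
    (G : K →L[ℂ] K) :
    BlockNonneg (QRV.opTensor A ((‖G‖ : ℂ) • (1 : K →L[ℂ] K))) (QRV.opTensor B G)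
      (QRV.opTensor C ((‖G‖ : ℂ) • (1 : K →L[ℂ] K))) := by
  rcases eq_or_ne G 0 with rfl | hG
  · simpa [opTensor_zero_right] using blockNonneg_zero
  have hstar : star (QRV.opTensor (1 : H →L[ℂ] H) G) * QRV.opTensor C 1 * QRV.opTensor 1 G =
      QRV.opTensor C (star G * G) := by
    rw [ContinuousLinearMap.star_eq_adjoint, adjoint_opTensor, ← opTensor_mul, ← opTensor_mul,
      mul_one, mul_one, ← ContinuousLinearMap.star_eq_adjoint,
      ← ContinuousLinearMap.star_eq_adjoint, star_one, one_mul]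
  have hU : star (QRV.opTensor (1 : H →L[ℂ] H) G) * QRV.opTensor C 1 * QRV.opTensor 1 G ≤
      ((‖G‖ ^ 2 : ℝ) : ℂ) • QRV.opTensor C 1 := by
    rw [hstar, ← opTensor_smul_right]
    exact opTensor_le_opTensor_right hC (star_mul_self_le_norm_sq_smul_one G)
  have hmul := h.opTensor_one.mul_right (norm_pos_iff.2 hG) hU
  rwa [← opTensor_mul, mul_one, one_mul, ← opTensor_smul_right, ← opTensor_smul_right] at hmul

end Blocks

section TensorProductBounds

variable {X : Type*} [MeasurableSpace X]

theorem ae_norm_le_toReal_eLpNormEssSup {E : Type*} [NormedAddCommGroup E] {μ : Measure X}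
    {f : X → E} (hf : eLpNormEssSup f μ < ∞) : ∀ᵐ x ∂μ, ‖f x‖ ≤ (eLpNormEssSup f μ).toReal := by
  filter_upwards [ae_le_eLpNormEssSup (f := f) (μ := μ)] with x hx
  simpa only [toReal_enorm] using ENNReal.toReal_mono hf.ne hx

variable {H : Type*} [NormedAddCommGroup H] [InnerProductSpace ℂ H] [CompleteSpace H]
variable {K : Type*} [NormedAddCommGroup K] [InnerProductSpace ℂ K] [CompleteSpace K]

theorem IsRNDeriv.isPositiveQRV [TopologicalSpace.SeparableSpace H] {ν : POVM X H}
    {μ : Measure X} [IsFiniteMeasure μ] {D : X → (H →L[ℂ] H)} (h : IsRNDeriv ν μ D)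
    (hD : eLpNormEssSup D μ < ∞) : IsPositiveQRV μ D :=
  ⟨h.1, h.ae_nonneg (ae_norm_le_toReal_eLpNormEssSup hD)⟩

variable [TopologicalSpace.SeparableSpace H] [TopologicalSpace.SeparableSpace K]

theorem IsPositiveQRV.exists_povm_isWeakDensity_funTensor {μ : Measure X} [IsFiniteMeasure μ]
    {D : X → (H →L[ℂ] H)} (hD : IsPositiveQRV μ D) (hD_fin : eLpNormEssSup D μ < ∞)
    {D' : X → (K →L[ℂ] K)} (hD' : IsPositiveQRV μ D') (hD'_fin : eLpNormEssSup D' μ < ∞) :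
    ∃ τ : POVM X (HTensor H K), IsWeakDensity τ μ (QRV.funTensor D D') := by
  have hDD' := hD.funTensor hD'
  refine hDD'.isQRV.exists_povm_isWeakDensity
    (C := (eLpNormEssSup D μ).toReal * (eLpNormEssSup D' μ).toReal) ?_ hDD'.ae_nonneg
  filter_upwards [ae_norm_le_toReal_eLpNormEssSup hD_fin,
    ae_norm_le_toReal_eLpNormEssSup hD'_fin] with x hx hx'
  exact (norm_opTensor_le _ _).trans (by gcongr)

variable {ν : POVM X H} {ρ : State H} {τ : POVM X (HTensor H K)} {D' : X → (K →L[ℂ] K)}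
  (h : IsWeakDensity τ (ν.stateMeasure ρ) (funTensor (rnDeriv ν (ν.stateMeasure ρ)) D'))
  (hD : IsPositiveQRV (ν.stateMeasure ρ) (rnDeriv ν (ν.stateMeasure ρ)))
  (hD' : IsPositiveQRV (ν.stateMeasure ρ) D') (hD'_fin : eLpNormEssSup D' (ν.stateMeasure ρ) < ∞)
  {σ : State (HTensor H K)} (hσ : σ.FullRank)
include h hD hD' hD'_fin hσ

theorem IsWeakDensity.pNorm_funTensor_norm_smul_one_le {f : X → (H →L[ℂ] H)} (hf : IsQRV f)
    {g : X → (K →L[ℂ] K)} (hg : IsQRV g) (hg_fin : eLpNormEssSup g (ν.stateMeasure ρ) < ∞) :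
    pNorm τ σ 1 (QRV.funTensor f fun x => (‖g x‖ : ℂ) • 1) ≤
      eLpNormEssSup g (ν.stateMeasure ρ) * eLpNormEssSup D' (ν.stateMeasure ρ) *
        pNorm ν ρ 1 f := by
  have hle : eLpNormEssSup (fun x => (‖g x‖ : ℂ) • (1 : K →L[ℂ] K)) (ν.stateMeasure ρ) ≤
      eLpNormEssSup g (ν.stateMeasure ρ) :=
    eLpNormEssSup_mono_enorm_ae (.of_forall fun x => enorm_le_iff_norm_le.2
      (norm_norm_smul_one_le (g x)))
  refine (h.pNorm_funTensor_le_of_nonneg hD hD' hD'_fin hσ hf hg.fun_norm_smul_one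
    (fun x => norm_smul_one_nonneg (g x)) (hle.trans_lt hg_fin)).trans ?_
  gcongr

theorem IsWeakDensity.decNorm_funTensor_le {f : X → (H →L[ℂ] H)} (hf : IsQRV f)
    {g : X → (K →L[ℂ] K)} (hg : IsQRV g) (hg_fin : eLpNormEssSup g (ν.stateMeasure ρ) < ∞) :
    decNorm τ σ 1 (QRV.funTensor f g) ≤
      eLpNormEssSup D' (ν.stateMeasure ρ) * decNorm ν ρ 1 f *
        eLpNormEssSup g (ν.stateMeasure ρ) := by
  suffices hle : decNorm τ σ 1 (QRV.funTensor f g) ≤ eLpNormEssSup g (ν.stateMeasure ρ) *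
      eLpNormEssSup D' (ν.stateMeasure ρ) * decNorm ν ρ 1 f from hle.trans_eq (by ring)
  refine le_const_mul_biInf ?_ (ENNReal.mul_lt_top hg_fin hD'_fin).ne ?_
  · have hF : (fun x => (‖f x‖ : ℂ) • (1 : H →L[ℂ] H)) ∈ qrvSpan X H ∧
        ∀ x, 0 ≤ (‖f x‖ : ℂ) • (1 : H →L[ℂ] H) :=
      ⟨mem_qrvSpan_iff.2 hf.fun_norm_smul_one, fun x => norm_smul_one_nonneg (f x)⟩
    exact ⟨(_, _), hF, hF, .of_forall fun x => blockNonneg_norm_smul_one (f x)⟩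
  · rintro ⟨S₁, S₂⟩ ⟨⟨hS₁, hS₁0⟩, ⟨hS₂, hS₂0⟩, hblock⟩
    rw [mem_qrvSpan_iff] at hS₁ hS₂
    have hmem : ∀ {S : X → (H →L[ℂ] H)}, IsQRV S → (∀ x, 0 ≤ S x) →
        (QRV.funTensor S fun x => (‖g x‖ : ℂ) • (1 : K →L[ℂ] K)) ∈ qrvSpan X (HTensor H K) ∧
          ∀ x, 0 ≤ QRV.funTensor S (fun x => (‖g x‖ : ℂ) • (1 : K →L[ℂ] K)) x := fun hS hS0 =>
      ⟨mem_qrvSpan_iff.2 (hS.funTensor hg.fun_norm_smul_one),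
        fun x => opTensor_nonneg (hS0 x) (norm_smul_one_nonneg (g x))⟩
    have hblock_tensor : ∀ᵐ x ∂(τ.stateMeasure σ),
        BlockNonneg (QRV.funTensor S₁ (fun x => (‖g x‖ : ℂ) • (1 : K →L[ℂ] K)) x)
          (QRV.funTensor f g x) (QRV.funTensor S₂ (fun x => (‖g x‖ : ℂ) • (1 : K →L[ℂ] K)) x) := by
      filter_upwards [h.absolutelyContinuous (hD.funTensor hD').ae_nonneg σ hblock] with x hx
      exact BlockNonneg.opTensor hx (hS₂0 x) (g x)
    refine (iInf₂_le (_, _) ⟨hmem hS₁ hS₁0, hmem hS₂ hS₂0, hblock_tensor⟩).trans (max_le ?_ ?_)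
    · exact (h.pNorm_funTensor_norm_smul_one_le hD hD' hD'_fin hσ hS₁ hg hg_fin).trans
        (by gcongr; exact le_max_left _ _)
    · exact (h.pNorm_funTensor_norm_smul_one_le hD hD' hD'_fin hσ hS₂ hg hg_fin).trans
        (by gcongr; exact le_max_right _ _)

theorem IsWeakDensity.pNorm_funTensor_sub_eq_zero {f f' : X → (H →L[ℂ] H)} (hf : IsQRV f)
    (hf' : IsQRV f') {g g' : X → (K →L[ℂ] K)} (hg : IsQRV g) (hg' : IsQRV g')
    (hg_fin : eLpNormEssSup g (ν.stateMeasure ρ) < ∞) (hff' : pNorm ν ρ 1 (f - f') = 0)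
    (hgg' : g =ᵐ[ν.stateMeasure ρ] g') :
    pNorm τ σ 1 (QRV.funTensor f g - QRV.funTensor f' g') = 0 := by
  have hae : QRV.funTensor f g - QRV.funTensor f' g' =ᵐ[τ.stateMeasure σ]
      QRV.funTensor (f - f') g := by
    filter_upwards [h.absolutelyContinuous (hD.funTensor hD').ae_nonneg σ hgg'] with x hx
    simp only [Pi.sub_apply, QRV.funTensor, opTensor_sub_left, hx]
  have hff'_qrv := hf.sub hf'
  refine nonpos_iff_eq_zero.1 ?_
  calc pNorm τ σ 1 (QRV.funTensor f g - QRV.funTensor f' g')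
      ≤ pNorm τ σ 1 (QRV.funTensor (f - f') g) :=
        pNorm_le_of_ae_eq τ σ 1 ((hf.funTensor hg).sub (hf'.funTensor hg'))
          (hff'_qrv.funTensor hg) hae
    _ ≤ 2 * eLpNormEssSup D' (ν.stateMeasure ρ) * pNorm ν ρ 1 (f - f') *
          eLpNormEssSup g (ν.stateMeasure ρ) :=
        h.pNorm_funTensor_le hD hD' hD'_fin hσ hff'_qrv hg hg_fin
    _ = 0 := by rw [hff', mul_zero, zero_mul]

end TensorProductBounds

end QRV

end

theorem mainTheorem7_general
    {X : Type*} [MeasurableSpace X]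
    {H : Type*} [NormedAddCommGroup H] [InnerProductSpace ℂ H] [CompleteSpace H]
    [TopologicalSpace.SeparableSpace H]
    {K : Type*} [NormedAddCommGroup K] [InnerProductSpace ℂ K] [CompleteSpace K]
    [TopologicalSpace.SeparableSpace K]
    (ν : QRV.POVM X H) (ν' : QRV.POVM X K) (ρ : QRV.State H)
    (hν : QRV.HasRNDeriv ν (ν.stateMeasure ρ)) (hν' : QRV.HasRNDeriv ν' (ν.stateMeasure ρ))
    (hν_fin : eLpNormEssSup (QRV.rnDeriv ν (ν.stateMeasure ρ)) (ν.stateMeasure ρ) < ∞)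
    (hν'_fin : eLpNormEssSup (QRV.rnDeriv ν' (ν.stateMeasure ρ)) (ν.stateMeasure ρ) < ∞) :
    (∃ τ : QRV.POVM X (QRV.HTensor H K), QRV.IsTensorPOVM ν ν' (ν.stateMeasure ρ) τ) ∧
    ∀ τ : QRV.POVM X (QRV.HTensor H K), QRV.IsTensorPOVM ν ν' (ν.stateMeasure ρ) τ →
      ∀ σ : QRV.State (QRV.HTensor H K), σ.FullRank →
        QRV.HasRNDeriv τ (τ.stateMeasure σ) ∧
        (∀ (f : X → (H →L[ℂ] H)) (g : X → (K →L[ℂ] K)), QRV.MemLpOp ν ρ 1 f →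
          QRV.IsQRV g ∧ eLpNormEssSup g (ν.stateMeasure ρ) < ∞ →
          QRV.MemLpOp τ σ 1 (QRV.funTensor f g) ∧
          QRV.pNorm τ σ 1 (QRV.funTensor f g) ≤
            2 * eLpNormEssSup (QRV.rnDeriv ν' (ν.stateMeasure ρ)) (ν.stateMeasure ρ) *
              QRV.pNorm ν ρ 1 f * eLpNormEssSup g (ν.stateMeasure ρ) ∧
          QRV.decNorm τ σ 1 (QRV.funTensor f g) ≤
            eLpNormEssSup (QRV.rnDeriv ν' (ν.stateMeasure ρ)) (ν.stateMeasure ρ) *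
              QRV.decNorm ν ρ 1 f * eLpNormEssSup g (ν.stateMeasure ρ)) ∧
        (∀ (f f' : X → (H →L[ℂ] H)) (g g' : X → (K →L[ℂ] K)),
          QRV.MemLpOp ν ρ 1 f → QRV.MemLpOp ν ρ 1 f' →
          QRV.IsQRV g ∧ eLpNormEssSup g (ν.stateMeasure ρ) < ∞ →
          QRV.IsQRV g' ∧ eLpNormEssSup g' (ν.stateMeasure ρ) < ∞ →
          QRV.pNorm ν ρ 1 (f - f') = 0 → g =ᵐ[ν.stateMeasure ρ] g' →
          QRV.pNorm τ σ 1 (QRV.funTensor f g - QRV.funTensor f' g') = 0) := by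
  have hD := hν.isRNDeriv_rnDeriv.isPositiveQRV hν_fin
  have hD' := hν'.isRNDeriv_rnDeriv.isPositiveQRV hν'_fin
  refine ⟨hD.exists_povm_isWeakDensity_funTensor hν_fin hD' hν'_fin, fun τ hτ σ hσ => ?_⟩
  have hτ : QRV.IsWeakDensity τ (ν.stateMeasure ρ) (QRV.funTensor _ _) := hτ
  refine ⟨⟨_, hτ.isRNDeriv (hD.funTensor hD').isQRV (hD.funTensor hD').ae_nonneg hσ⟩,
    fun f g hf hg => ?_, fun f f' g g' hf hf' hg hg' hff' hgg' => ?_⟩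
  · have hf_qrv := QRV.mem_qrvSpan_iff.1 hf.1
    have hle := hτ.pNorm_funTensor_le hD hD' hν'_fin hσ hf_qrv hg.1 hg.2
    have hlt := ENNReal.mul_lt_top (ENNReal.mul_lt_top
      (ENNReal.mul_lt_top (ENNReal.ofNat_lt_top (n := 2)) hν'_fin) hf.2) hg.2
    exact ⟨⟨QRV.mem_qrvSpan_iff.2 (hf_qrv.funTensor hg.1), hle.trans_lt hlt⟩, hle,
      hτ.decNorm_funTensor_le hD hD' hν'_fin hσ hf_qrv hg.1 hg.2⟩
  · exact hτ.pNorm_funTensor_sub_eq_zero hD hD' hν'_fin hσ (QRV.mem_qrvSpan_iff.1 hf.1)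
      (QRV.mem_qrvSpan_iff.1 hf'.1) hg.1 hg'.1 hg.2 hff' hgg'

theorem mainTheorem7
    {X : Type*} [TopologicalSpace X] [LocallyCompactSpace X] [T2Space X]
    [MeasurableSpace X] [BorelSpace X]
    {H : Type*} [NormedAddCommGroup H] [InnerProductSpace ℂ H] [CompleteSpace H]
    [TopologicalSpace.SeparableSpace H]
    (ν : QRV.POVM X H) (ρ : QRV.State H) (hρ : ρ.FullRank)
    (hν : QRV.HasRNDeriv ν (ν.stateMeasure ρ))
    (hbdd : QRV.MemLinfOp ν ρ (QRV.rnDeriv ν (ν.stateMeasure ρ)))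
    (hinv : ∀ᵐ x ∂(ν.stateMeasure ρ), IsUnit (QRV.rnDeriv ν (ν.stateMeasure ρ) x)) :
    (∃ τ : QRV.POVM X (QRV.HTensor H H), QRV.IsTensorPOVM ν ν (ν.stateMeasure ρ) τ) ∧
    ∀ τ : QRV.POVM X (QRV.HTensor H H), QRV.IsTensorPOVM ν ν (ν.stateMeasure ρ) τ →
      ∀ σ : QRV.State (QRV.HTensor H H), σ.FullRank →
        QRV.HasRNDeriv τ (τ.stateMeasure σ) ∧
        (∀ f g : X → (H →L[ℂ] H), QRV.MemLpOp ν ρ 1 f → QRV.MemLinfOp ν ρ g →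
          QRV.MemLpOp τ σ 1 (QRV.funTensor f g) ∧
          QRV.pNorm τ σ 1 (QRV.funTensor f g) ≤
            2 * QRV.supNorm ν ρ (QRV.rnDeriv ν (ν.stateMeasure ρ)) *
              QRV.pNorm ν ρ 1 f * QRV.supNorm ν ρ g ∧
          QRV.decNorm τ σ 1 (QRV.funTensor f g) ≤
            QRV.supNorm ν ρ (QRV.rnDeriv ν (ν.stateMeasure ρ)) *
              QRV.decNorm ν ρ 1 f * QRV.supNorm ν ρ g) ∧
        -- the class of `f ⊗ g` depends only on the classes of `f` and `g`
        (∀ f f' g g' : X → (H →L[ℂ] H),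
          QRV.MemLpOp ν ρ 1 f → QRV.MemLpOp ν ρ 1 f' →
          QRV.MemLinfOp ν ρ g → QRV.MemLinfOp ν ρ g' →
          QRV.pNorm ν ρ 1 (f - f') = 0 → g =ᵐ[ν.stateMeasure ρ] g' →
          QRV.pNorm τ σ 1 (QRV.funTensor f g - QRV.funTensor f' g') = 0) := by
  exact mainTheorem7_general ν ν ρ hν hν hbdd.2 hbdd.2
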